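/- Let $d\ge 1$, $\beta\in(0,1)$, $a\in[0,1]$, and let $\alpha=(\alpha_x)_{x\in\mathbb Z^d}$ be i.i.d. $\{1,2,\dots\}$-valued random variables with product law $\mathbb Q$ such that $\mathbb Q(\alpha_0>u)=u^{-\beta}(1+o(1))$ as $u\to\infty$. Given $\alpha$, let $X$ be the continuous-time random walk on $\mathbb Z^d$ (Bouchaud trap model) with generator $$Ag(x)=\alpha_x^{a-1}\sum_{y\sim x}\alpha_y^a\,(g(y)-g(x)),$$ where $y\sim x$ means $|y-x|=1$, with transition probabilities $\mathbf P^\alpha_x(X_t=y)$ given by the minimal non-negative solution of the Kolmogorov backward equation. Let $(\eta_t)_{t\ge0}$ be the partial exclusion process on $\Xi=\prod_{x\in\mathbb Z^d}\{0,\dots,\alpha_x\}$, i.e. a càdlàg $\Xi$-valued process solving the martingale problem for the generator $$\mathcal L\varphi(\eta)=\sum_{x\in\mathbb Z^d}\eta(x)\,\alpha_x^{a-1}\sum_{y\sim x}\alpha_y^a\Big(1-\frac{\eta(y)}{\alpha_y}\Big)\big(\varphi(\eta-\delta_x+\delta_y)-\varphi(\eta)\big)$$ on functions $\varphi$ depending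 on finitely many coordinates; $\mathbb E_\eta$ is the expectation when $\eta_0=\eta$. For an integer $n\ge1$ put $\theta_n=n^{1+1/\beta}$ if $d=1$, $\theta_n=n^{2/\beta}(\log n)^{1-1/\beta}$ if $d=2$ (with $\theta_1:=1$), and $\theta_n=n^{2/\beta}$ if $d\ge3$. Let $$\mathcal X^n_t=\frac1{n^{d/\beta}}\sum_{x\in\mathbb Z^d}\eta_{t\theta_n}(x)\,\delta_{x/n},\qquad P^n_tg(x/n)=\mathbf E^\alpha_x\big[g(X_{t\theta_n}/n)\big],\quad x\in\mathbb Z^d,$$ and write $\langle\mu|g\rangle=\int g\,d\mu$. Then, $\mathbb Q$-a.s., for every $\eta\in\Xi$, $t\ge0$, integer $n\ge1$, and every non-negative, continuous, compactly supported $f:\mathbb R^d\to\mathbb R$, all the pairings and the expectation below are well-defined and finite, and $$\mathbb E_\eta\Big[\big(\langle\mathcal X^n_t|f\rangle-\langle\mathcal X^n_0|P^n_tf\rangle\big)^2\Big]\le\frac1{n^{d/\beta}}\,\big\langle\mathcal X^n_0\,\big|\,P^n_t(f^2)-(P^n_tf)^2\big\rangle.$$ -/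

import Mathlib

open MeasureTheory ProbabilityTheory Filter Topology
open scoped NNReal ENNReal

noncomputable section

namespace BouchaudExclusion

/-! ### The random environment -/

/-- The positive integers carry the discrete σ-algebra. -/
instance instMeasurableSpacePNat : MeasurableSpace ℕ+ := ⊤

instance instDiscreteMeasurableSpacePNat : DiscreteMeasurableSpace ℕ+ := ⟨fun _ => trivial⟩

/-- The lattice `ℤ^d`. -/
abbrev Site (d : ℕ) : Type := Fin d → ℤ

/-- Environments `α : ℤ^d → {1, 2, …}`. -/
abbrev Env (d : ℕ) : Type := Site d → ℕ+

/-- The heavy-tail condition `ν(α₀ > u) = u ^ (-β) (1 + o(1))` as `u → ∞` on the one-site law. -/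
def HeavyTailed (ν : Measure ℕ+) (β : ℝ) : Prop :=
  Asymptotics.IsEquivalent atTop
    (fun u : ℝ => ν.real {k : ℕ+ | u < (k : ℝ)}) (fun u : ℝ => u ^ (-β))

/-- The law of an i.i.d. environment with one-site law `ν`: the product measure. -/
def envLaw (d : ℕ) (ν : Measure ℕ+) : Measure (Env d) :=
  Measure.infinitePi fun _ : Site d => ν

/-- The `2d` nearest neighbours `x ± e_i` of `x` in `ℤ^d`. -/
def nbrs {d : ℕ} (x : Site d) : Finset (Site d) :=
  (Finset.univ ×ˢ ({1, -1} : Finset ℤ)).image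
    fun p : Fin d × ℤ => x + Pi.single p.1 p.2

/-! ### The Bouchaud trap model and its rescaled semigroup -/

/-- Jump rate of the Bouchaud trap model `BTM(a)` from `x` to a nearest neighbour `y`, so that its
generator is `A g x = ∑_{y ∼ x} btmRate a α x y * (g y - g x)`. -/
def btmRate {d : ℕ} (a : ℝ) (α : Env d) (x y : Site d) : ℝ :=
  (α x : ℝ) ^ (a - 1) * (α y : ℝ) ^ a

/-- Total jump rate of `BTM(a)` out of `x`. -/
def btmExitRate {d : ℕ} (a : ℝ) (α : Env d) (x : Site d) : ℝ :=
  ∑ y ∈ nbrs x, btmRate a α x y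

/-- Probability that `BTM(a)` started from `x` is at `y` at time `t` after fewer than `k` jumps,
computed by conditioning on the time `s` and the target `z` of the first jump. -/
def btmIter {d : ℕ} (a : ℝ) (α : Env d) : ℕ → ℝ → Site d → Site d → ℝ≥0∞
  | 0, _, _, _ => 0
  | k + 1, t, x, y =>
      (if x = y then ENNReal.ofReal (Real.exp (-(btmExitRate a α x * t))) else 0) +
        ∫⁻ s in Set.Icc (0 : ℝ) t,
          ENNReal.ofReal (Real.exp (-(btmExitRate a α x * s))) *
            ∑ z ∈ nbrs x, ENNReal.ofReal (btmRate a α x z) * btmIter a α k (t - s) z y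

/-- Transition probabilities `𝐏_x(X_t = y)` of the continuous-time random walk `BTM(a)` with the
rates `btmRate`: the increasing limit of `btmIter`, i.e. the minimal non-negative solution of the
Kolmogorov backward equation. No conservativeness (non-explosion) is built in. -/
def btmTransition {d : ℕ} (a : ℝ) (α : Env d) (t : ℝ) (x y : Site d) : ℝ≥0∞ :=
  ⨆ k : ℕ, btmIter a α k t x y

/-- The point `x / n` of `ℝ^d`. -/
def scaledSite {d : ℕ} (n : ℕ) (x : Site d) : EuclideanSpace ℝ (Fin d) :=
  WithLp.toLp 2 fun i => (x i : ℝ) / (n : ℝ)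

/-- The time scale `θ_n`. For `d = 2` and `n = 1` the formula has a vanishing logarithm raised to
a negative power; we set `θ_1 = 1` there, which is its value in all other dimensions. -/
def timeScale (d : ℕ) (β : ℝ) (n : ℕ) : ℝ≥0 :=
  Real.toNNReal <|
    if d = 1 then (n : ℝ) ^ (1 + 1 / β)
    else if d = 2 then
      if n = 1 then 1 else (n : ℝ) ^ (2 / β) * Real.log n ^ (1 - 1 / β)
    else (n : ℝ) ^ (2 / β)

/-- The rescaled semigroup `P^n_t g (x / n) = 𝐄_x[g(X_{t θ_n} / n)]`. It is a function on the
rescaled lattice `ℤ^d / n`, extended to `ℝ^d` by `0`; only its values on `ℤ^d / n` are ever used. -/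
def semigroup {d : ℕ} (a β : ℝ) (α : Env d) (n : ℕ) (t : ℝ≥0)
    (g : EuclideanSpace ℝ (Fin d) → ℝ) : EuclideanSpace ℝ (Fin d) → ℝ :=
  Function.extend (scaledSite n)
    (fun x : Site d => ∑' y : Site d,
      (btmTransition a α ((t * timeScale d β n : ℝ≥0) : ℝ) x y).toReal * g (scaledSite n y))
    0

/-! ### The partial exclusion process -/

/-- Configurations `Ξ = ∏_x {0, …, α_x}`, with the product topology and σ-algebra. -/
abbrev Config {d : ℕ} (α : Env d) : Type := ∀ x : Site d, Fin ((α x : ℕ) + 1)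

/-- The configuration `η^{x,y}` (for `x ≠ y`): one particle of `η` is moved from `x` to `y`, if
there is a particle at `x` and room at `y`. -/
def move {d : ℕ} {α : Env d} (η : Config α) (x y : Site d) : Config α :=
  if h : 0 < (η x : ℕ) ∧ (η y : ℕ) < (α y : ℕ) then
    Function.update
      (Function.update η x ⟨(η x : ℕ) - 1, lt_of_le_of_lt (Nat.sub_le _ _) (η x).isLt⟩)
      y ⟨(η y : ℕ) + 1, Nat.succ_lt_succ h.2⟩
  else η

/-- Local functions: those which depend on finitely many sites only. -/
def IsLocal {d : ℕ} {α : Env d} (φ : Config α → ℝ) : Prop :=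
  ∃ S : Finset (Site d), DependsOn φ (S : Set (Site d))

/-- The generator of the exclusion process. For a local function `φ` only finitely many terms of
the sum over `x` are nonzero. -/
def exclGen {d : ℕ} (a : ℝ) (α : Env d) (φ : Config α → ℝ) (η : Config α) : ℝ :=
  ∑' x : Site d, ∑ y ∈ nbrs x,
    ((η x : ℕ) : ℝ) * (α x : ℝ) ^ (a - 1) * ((α y : ℝ) ^ a * (1 - ((η y : ℕ) : ℝ) / (α y : ℝ))) *
      (φ (move η x y) - φ η)

/-- `ξ` is, under `P`, the partial exclusion process with generator `exclGen a α` on local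
functions, started from `η`: a càdlàg process which solves the martingale problem. -/
structure IsExclusionProcess {d : ℕ} (a : ℝ) (α : Env d) (η : Config α)
    {Ω : Type*} {mΩ : MeasurableSpace Ω} (P : Measure Ω) (ξ : ℝ≥0 → Ω → Config α) : Prop where
  right_continuous : ∀ ω t, ContinuousWithinAt (fun s => ξ s ω) (Set.Ici t) t
  left_limits : ∀ ω t, ∃ ζ : Config α, Tendsto (fun s => ξ s ω) (𝓝[<] t) (𝓝 ζ)
  initial : ∀ᵐ ω ∂P, ξ 0 ω = η
  martingale_problem : ∃ ℱ : Filtration ℝ≥0 mΩ, (∀ t, Measurable[ℱ t] (ξ t)) ∧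
    ∀ φ : Config α → ℝ, IsLocal φ →
      Martingale
        (fun (t : ℝ≥0) (ω : Ω) =>
          φ (ξ t ω) - φ (ξ 0 ω) - ∫ s in (0 : ℝ)..t, exclGen a α φ (ξ s.toNNReal ω))
        ℱ P

/-- The empirical density field `n ^ (-d/β) ∑_x η(x) δ_{x/n}` of a configuration `η`. -/
def densityField {d : ℕ} (β : ℝ) (n : ℕ) {α : Env d} (η : Config α) :
    Measure (EuclideanSpace ℝ (Fin d)) :=
  ENNReal.ofReal (1 / (n : ℝ) ^ ((d : ℝ) / β)) •
    Measure.sum fun x : Site d => ((η x : ℕ) : ℝ≥0∞) • Measure.dirac (scaledSite n x)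

end BouchaudExclusion

end

/-!
The generator of the exclusion process maps the linear functional `∑ x, g x * η x` to
`∑ x, (A g) x * η x`, where `A` is the generator of `BTM(a)`, because the exclusion corrections
cancel in pairs of neighbours. Hence the mean of the density field at time `t` is `P_t f` paired
with the initial configuration, and the variance is the integrated carré du champ. The exclusion
factor can only lower the carré du champ below its value for independent particles, and the latter
integrates to `P_t (f²) - (P_t f)²`.

The semigroup is not local, so the argument is run with the walk killed at its `k`-th jump, which
turns `P_{t-s} f` into a finitely supported non-negative subsolution of the backward equation.
By reversibility with respect to `α`, the mass lost in this way is controlled by the Laplace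
transform of the time of the `k`-th jump, and it vanishes in the limit when `BTM(a)` does not
explode. Explosion is almost surely excluded by a Peierls count: the sites with small `α` occur
with positive density along every long enough path.
-/

noncomputable section

namespace BouchaudExclusion

variable {d : ℕ} {a : ℝ} {α : Env d}

section Lattice

lemma mem_nbrs_iff {x y : Site d} :
    y ∈ nbrs x ↔ ∃ i : Fin d, y = x + Pi.single i 1 ∨ y = x + Pi.single i (-1) := by
  simp [nbrs, eq_comm]

lemma mem_nbrs_comm {x y : Site d} : y ∈ nbrs x ↔ x ∈ nbrs y := by
  have key : ∀ x y : Site d, y ∈ nbrs x → x ∈ nbrs y := by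
    intro x y h
    obtain ⟨i, rfl | rfl⟩ := mem_nbrs_iff.1 h
    · exact mem_nbrs_iff.2 ⟨i, .inr (by simp [add_assoc, ← Pi.single_add])⟩
    · exact mem_nbrs_iff.2 ⟨i, .inl (by simp [add_assoc, ← Pi.single_add])⟩
  exact ⟨key x y, key y x⟩

lemma ne_of_mem_nbrs {x y : Site d} (h : y ∈ nbrs x) : x ≠ y := by
  rintro rfl
  obtain ⟨i, h | h⟩ := mem_nbrs_iff.1 h <;> simpa using congrFun h i

lemma card_nbrs_le (x : Site d) : (nbrs x).card ≤ 2 * d := by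
  refine Finset.card_image_le.trans ?_
  simp [Finset.card_product, mul_comm]

/-- The closed neighbourhood of a finite set of sites: all sites at distance at most one from it.
Its iterates on `{x}` are the balls around `x` for the graph distance. -/
def closedNbhd (S : Finset (Site d)) : Finset (Site d) :=
  S.biUnion fun x => insert x (nbrs x)

lemma mem_closedNbhd_singleton {x y : Site d} :
    y ∈ closedNbhd {x} ↔ y = x ∨ y ∈ nbrs x := by
  simp [closedNbhd]

lemma mem_closedNbhd_singleton_comm {x y : Site d} :
    y ∈ closedNbhd {x} ↔ x ∈ closedNbhd {y} := by
  rw [mem_closedNbhd_singleton, mem_closedNbhd_singleton, mem_nbrs_comm, eq_comm]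

lemma subset_closedNbhd (S : Finset (Site d)) : S ⊆ closedNbhd S := fun x hx =>
  Finset.mem_biUnion.2 ⟨x, hx, Finset.mem_insert_self _ _⟩

lemma mem_closedNbhd_of_mem_nbrs {S : Finset (Site d)} {x y : Site d} (hx : x ∈ S)
    (h : y ∈ nbrs x) : y ∈ closedNbhd S :=
  Finset.mem_biUnion.2 ⟨x, hx, Finset.mem_insert_of_mem h⟩

lemma closedNbhd_mono : Monotone (closedNbhd (d := d)) := fun _ _ h =>
  Finset.biUnion_subset_biUnion_of_subset_left _ h

lemma subset_iterate_closedNbhd (k : ℕ) (S : Finset (Site d)) : S ⊆ closedNbhd^[k] S :=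
  Function.id_le_iterate_of_id_le subset_closedNbhd k S

lemma iterate_closedNbhd_subset_succ {x z : Site d} (h : z ∈ closedNbhd {x}) (k : ℕ) :
    closedNbhd^[k] {z} ⊆ closedNbhd^[k + 1] {x} := by
  rw [Function.iterate_succ_apply]
  exact closedNbhd_mono.iterate k (Finset.singleton_subset_iff.2 h)

lemma card_closedNbhd_le (S : Finset (Site d)) :
    (closedNbhd S).card ≤ S.card * (2 * d + 1) :=
  Finset.card_biUnion_le_card_mul _ _ _ fun x _ =>
    (Finset.card_insert_le _ _).trans (by gcongr; exact card_nbrs_le x)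

lemma card_iterate_closedNbhd_singleton_le (k : ℕ) (x : Site d) :
    (closedNbhd^[k] {x}).card ≤ (2 * d + 1) ^ k := by
  induction k with
  | zero => simp
  | succ k ih =>
    rw [Function.iterate_succ_apply', pow_succ]
    exact (card_closedNbhd_le _).trans (by gcongr)

end Lattice

section Rates

lemma env_pos (α : Env d) (x : Site d) : (0 : ℝ) < α x := by
  exact_mod_cast (α x).pos

lemma btmRate_nonneg (x y : Site d) : 0 ≤ btmRate a α x y :=
  mul_nonneg (Real.rpow_nonneg (env_pos α x).le _) (Real.rpow_nonneg (env_pos α y).le _)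

lemma btmExitRate_nonneg (x : Site d) : 0 ≤ btmExitRate a α x :=
  Finset.sum_nonneg fun _ _ => btmRate_nonneg _ _

/-- Detailed balance of `BTM(a)` with respect to the measure `α`. -/
lemma env_mul_btmRate_comm (x y : Site d) :
    (α x : ℝ) * btmRate a α x y = α y * btmRate a α y x := by
  have h : ∀ z, (α z : ℝ) * (α z : ℝ) ^ (a - 1) = (α z : ℝ) ^ a := fun z => by
    rw [Real.rpow_sub_one (env_pos α z).ne']
    field_simp [(env_pos α z).ne']
  simp only [btmRate, ← mul_assoc, h]
  exact mul_comm _ _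

end Rates

section LinearODE

variable {q : ℝ} {E h : ℝ → ℝ}

/-- Multiply by the integrating factor `exp (q t)`. -/
lemma nonneg_of_hasDerivAt_linear
    (hE : ∀ t, 0 ≤ t → HasDerivAt E (-q * E t + h t) t) (hh : ∀ t, 0 ≤ t → 0 ≤ h t)
    (h0 : 0 ≤ E 0) {t : ℝ} (ht : 0 ≤ t) : 0 ≤ E t := by
  have hd : ∀ s, 0 ≤ s →
      HasDerivAt (fun s => Real.exp (q * s) * E s) (Real.exp (q * s) * h s) s := by
    intro s hs
    have hexp : HasDerivAt (fun s => Real.exp (q * s)) (Real.exp (q * s) * q) s := by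
      simpa using ((hasDerivAt_id s).const_mul q).exp
    refine (hexp.fun_mul (hE s hs)).congr_deriv ?_
    ring
  have hm : MonotoneOn (fun s => Real.exp (q * s) * E s) (Set.Ici 0) := by
    refine monotoneOn_of_hasDerivWithinAt_nonneg (convex_Ici 0)
      (fun s hs => (hd s hs).continuousAt.continuousWithinAt)
      (f' := fun s => Real.exp (q * s) * h s) (fun s hs => ?_) (fun s hs => ?_) <;>
      rw [interior_Ici] at hs
    · exact (hd s (le_of_lt hs)).hasDerivWithinAt
    · exact mul_nonneg (Real.exp_nonneg _) (hh s (le_of_lt hs))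
  have hle := hm Set.self_mem_Ici ht ht
  simp only [mul_zero, Real.exp_zero, one_mul] at hle
  exact nonneg_of_mul_nonneg_right (h0.trans hle) (Real.exp_pos _)

lemma eq_zero_of_hasDerivAt_linear
    (hE : ∀ t, 0 ≤ t → HasDerivAt E (-q * E t + h t) t) (hh : ∀ t, 0 ≤ t → h t = 0)
    (h0 : E 0 = 0) {t : ℝ} (ht : 0 ≤ t) : E t = 0 := by
  refine le_antisymm ?_ (nonneg_of_hasDerivAt_linear hE (fun t ht => (hh t ht).ge) h0.ge ht)
  have hneg : 0 ≤ -E t :=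
    nonneg_of_hasDerivAt_linear (q := q) (E := fun t => -E t) (h := fun t => -h t)
      (fun t ht => (hE t ht).fun_neg.congr_deriv (by ring)) (fun t ht => by rw [hh t ht, neg_zero])
      (by rw [h0, neg_zero]) ht
  exact neg_nonneg.1 hneg

end LinearODE

section TruncatedTransition

/-- The real-valued version of `btmIter`: the probability of being at `y` at time `t`, starting
from `x`, after fewer than `k` jumps. The integration variable is the time remaining after the
first jump rather than the time of that jump, so that `btmProb` can be differentiated in `t`. -/
def btmProb (a : ℝ) (α : Env d) : ℕ → ℝ → Site d → Site d → ℝ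
  | 0, _, _, _ => 0
  | k + 1, t, x, y =>
      Real.exp (-(btmExitRate a α x * t)) * ((if x = y then 1 else 0) +
        ∫ u in (0 : ℝ)..t, Real.exp (btmExitRate a α x * u) *
          ∑ z ∈ nbrs x, btmRate a α x z * btmProb a α k u z y)

/-- The gain term of the Kolmogorov backward equation for `btmProb`. -/
def backwardFlux (a : ℝ) (α : Env d) (k : ℕ) (t : ℝ) (x y : Site d) : ℝ :=
  ∑ z ∈ nbrs x, btmRate a α x z * btmProb a α k t z y

/-- The gain term of the Kolmogorov forward equation for `btmProb`. -/
def forwardFlux (a : ℝ) (α : Env d) (k : ℕ) (t : ℝ) (x y : Site d) : ℝ :=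
  ∑ z ∈ nbrs y, btmProb a α k t x z * btmRate a α z y

lemma btmProb_succ (k : ℕ) (t : ℝ) (x y : Site d) :
    btmProb a α (k + 1) t x y = Real.exp (-(btmExitRate a α x * t)) * ((if x = y then 1 else 0) +
      ∫ u in (0 : ℝ)..t, Real.exp (btmExitRate a α x * u) * backwardFlux a α k u x y) := rfl

lemma btmProb_succ_zero (k : ℕ) (x y : Site d) :
    btmProb a α (k + 1) 0 x y = if x = y then 1 else 0 := by
  simp [btmProb]

lemma continuous_btmProb (k : ℕ) (x y : Site d) :
    Continuous fun t => btmProb a α k t x y := by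
  induction k generalizing x with
  | zero => exact continuous_const
  | succ k ih =>
    have hint : Continuous fun u => Real.exp (btmExitRate a α x * u) *
        ∑ z ∈ nbrs x, btmRate a α x z * btmProb a α k u z y := by
      fun_prop
    refine .mul (by fun_prop) (continuous_const.add ?_)
    exact intervalIntegral.continuous_primitive (fun a b => hint.intervalIntegrable a b) 0

lemma continuous_backwardFlux (k : ℕ) (x y : Site d) :
    Continuous fun t => backwardFlux a α k t x y :=
  continuous_finsetSum _ fun z _ => (continuous_btmProb k z y).const_mul _

/-- The Kolmogorov backward equation, truncated by the number of jumps. -/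
lemma hasDerivAt_btmProb (k : ℕ) (x y : Site d) (t : ℝ) :
    HasDerivAt (fun t => btmProb a α (k + 1) t x y)
      (-btmExitRate a α x * btmProb a α (k + 1) t x y + backwardFlux a α k t x y) t := by
  have hc : Continuous fun u => Real.exp (btmExitRate a α x * u) * backwardFlux a α k u x y :=
    (by fun_prop : Continuous fun u => Real.exp (btmExitRate a α x * u)).mul
      (continuous_backwardFlux k x y)
  have hint := (intervalIntegral.integral_hasDerivAt_right (hc.intervalIntegrable 0 t)
    (hc.stronglyMeasurableAtFilter _ _) hc.continuousAt).const_add (if x = y then (1 : ℝ) else 0)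
  have hexp : HasDerivAt (fun s => Real.exp (-(btmExitRate a α x * s)))
      (Real.exp (-(btmExitRate a α x * t)) * -btmExitRate a α x) t := by
    simpa using ((hasDerivAt_id t).const_mul (btmExitRate a α x)).neg.exp
  simp only [btmProb_succ]
  refine (hexp.mul hint).congr_deriv ?_
  rw [← mul_assoc, ← Real.exp_add, neg_add_cancel, Real.exp_zero]
  ring

lemma btmProb_nonneg (k : ℕ) (x y : Site d) {t : ℝ} (ht : 0 ≤ t) : 0 ≤ btmProb a α k t x y := by
  induction k generalizing x t with
  | zero => exact le_rfl
  | succ k ih =>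
    refine nonneg_of_hasDerivAt_linear (fun t _ => hasDerivAt_btmProb k x y t)
      (fun t ht => ?_) ?_ ht
    · exact Finset.sum_nonneg fun z _ => mul_nonneg (btmRate_nonneg _ _) (ih z ht)
    · rw [btmProb_succ_zero]; split_ifs <;> norm_num

lemma backwardFlux_nonneg (k : ℕ) (x y : Site d) {t : ℝ} (ht : 0 ≤ t) :
    0 ≤ backwardFlux a α k t x y :=
  Finset.sum_nonneg fun z _ => mul_nonneg (btmRate_nonneg _ _) (btmProb_nonneg k z y ht)

lemma btmProb_le_succ (k : ℕ) (x y : Site d) {t : ℝ} (ht : 0 ≤ t) :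
    btmProb a α k t x y ≤ btmProb a α (k + 1) t x y := by
  induction k generalizing x t with
  | zero => exact btmProb_nonneg 1 x y ht
  | succ k ih =>
    rw [← sub_nonneg]
    refine nonneg_of_hasDerivAt_linear (q := btmExitRate a α x)
      (E := fun t => btmProb a α (k + 1 + 1) t x y - btmProb a α (k + 1) t x y)
      (h := fun t => backwardFlux a α (k + 1) t x y - backwardFlux a α k t x y)
      (fun t _ => ?_) (fun t ht => ?_) ?_ ht
    · refine ((hasDerivAt_btmProb (k + 1) x y t).sub (hasDerivAt_btmProb k x y t)).congr_deriv ?_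
      ring
    · exact sub_nonneg.2 (Finset.sum_le_sum fun z _ =>
        mul_le_mul_of_nonneg_left (ih z ht) (btmRate_nonneg _ _))
    · simp only [btmProb_succ_zero, sub_self, le_refl]

lemma btmProb_monotone (x y : Site d) {t : ℝ} (ht : 0 ≤ t) :
    Monotone fun k => btmProb a α k t x y :=
  monotone_nat_of_le_succ fun k => btmProb_le_succ k x y ht

lemma btmProb_eq_zero (k : ℕ) (t : ℝ) {x y : Site d} (h : y ∉ closedNbhd^[k] {x}) :
    btmProb a α k t x y = 0 := by
  induction k generalizing x t with
  | zero => rfl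
  | succ k ih =>
    have hxy : x ≠ y := by
      rintro rfl
      exact h (subset_iterate_closedNbhd _ _ (Finset.mem_singleton_self x))
    have hz : ∀ u, backwardFlux a α k u x y = 0 := fun u => Finset.sum_eq_zero fun z hz => by
      rw [ih u fun hy => h (iterate_closedNbhd_subset_succ
        (mem_closedNbhd_singleton.2 (.inr hz)) k hy), mul_zero]
    simp [btmProb_succ, hxy, hz]

end TruncatedTransition

section Duhamel

lemma btmProb_succ_eq_integral_sub (k : ℕ) (t : ℝ) (x y : Site d) :
    btmProb a α (k + 1) t x y =
      (if x = y then Real.exp (-(btmExitRate a α x * t)) else 0) +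
        ∫ s in (0 : ℝ)..t, Real.exp (-(btmExitRate a α x * s)) *
          backwardFlux a α k (t - s) x y := by
  have hsub := intervalIntegral.integral_comp_sub_left (a := 0) (b := t)
    (fun u => Real.exp (-(btmExitRate a α x * (t - u))) * backwardFlux a α k u x y) t
  simp only [sub_sub_cancel, sub_self, sub_zero] at hsub
  rw [btmProb_succ, mul_add, hsub, ← intervalIntegral.integral_const_mul, mul_ite, mul_one,
    mul_zero]
  congr 1
  refine intervalIntegral.integral_congr fun u _ => ?_
  rw [← mul_assoc, ← Real.exp_add]
  ring_nf

lemma lintegral_Icc_ofReal_eq_ofReal_integral {f : ℝ → ℝ} (hf : Continuous f) {s t : ℝ}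
    (hst : s ≤ t) (h0 : ∀ u ∈ Set.Icc s t, 0 ≤ f u) :
    ∫⁻ u in Set.Icc s t, ENNReal.ofReal (f u) = ENNReal.ofReal (∫ u in s..t, f u) := by
  rw [intervalIntegral.integral_of_le hst, ← integral_Icc_eq_integral_Ioc,
    ofReal_integral_eq_lintegral_ofReal hf.continuousOn.integrableOn_Icc]
  exact (ae_restrict_iff' measurableSet_Icc).2 (ae_of_all _ h0)

lemma btmIter_eq_ofReal (k : ℕ) (x y : Site d) {t : ℝ} (ht : 0 ≤ t) :
    btmIter a α k t x y = ENNReal.ofReal (btmProb a α k t x y) := by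
  induction k generalizing x t with
  | zero => simp [btmIter, btmProb]
  | succ k ih =>
    set F : ℝ → ℝ := fun s => Real.exp (-(btmExitRate a α x * s)) *
      backwardFlux a α k (t - s) x y
    have hF : Continuous F :=
      (by fun_prop : Continuous fun s => Real.exp (-(btmExitRate a α x * s))).mul
        ((continuous_backwardFlux k x y).comp (continuous_const.sub continuous_id))
    have hF0 : ∀ s ∈ Set.Icc 0 t, 0 ≤ F s := fun s hs =>
      mul_nonneg (Real.exp_nonneg _) (backwardFlux_nonneg k x y (sub_nonneg.2 hs.2))
    have hflux : ∀ s ∈ Set.Icc 0 t, ENNReal.ofReal (Real.exp (-(btmExitRate a α x * s))) *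
        ∑ z ∈ nbrs x, ENNReal.ofReal (btmRate a α x z) * btmIter a α k (t - s) z y
        = ENNReal.ofReal (F s) := by
      intro s hs
      have hts : 0 ≤ t - s := sub_nonneg.2 hs.2
      rw [ENNReal.ofReal_mul (Real.exp_nonneg _), backwardFlux, ENNReal.ofReal_sum_of_nonneg
        fun z _ => mul_nonneg (btmRate_nonneg _ _) (btmProb_nonneg k z y hts)]
      simp only [ENNReal.ofReal_mul (btmRate_nonneg _ _), ih _ hts]
    rw [btmIter, setLIntegral_congr_fun measurableSet_Icc hflux,
      lintegral_Icc_ofReal_eq_ofReal_integral hF ht hF0, btmProb_succ_eq_integral_sub,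
      ENNReal.ofReal_add (by split_ifs <;> positivity) (intervalIntegral.integral_nonneg ht hF0),
      apply_ite ENNReal.ofReal, ENNReal.ofReal_zero]

end Duhamel

section Reversibility

lemma backwardFlux_succ_zero (k : ℕ) (x y : Site d) :
    backwardFlux a α (k + 1) 0 x y = if y ∈ nbrs x then btmRate a α x y else 0 := by
  simp only [backwardFlux, btmProb_succ_zero, mul_ite, mul_one, mul_zero, Finset.sum_ite_eq']

lemma forwardFlux_succ_zero (k : ℕ) (x y : Site d) :
    forwardFlux a α (k + 1) 0 x y = if y ∈ nbrs x then btmRate a α x y else 0 := by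
  simp only [forwardFlux, btmProb_succ_zero, ite_mul, one_mul, zero_mul, Finset.sum_ite_eq,
    mem_nbrs_comm (x := x)]

lemma hasDerivAt_backwardFlux (k : ℕ) (x y : Site d) (t : ℝ) :
    HasDerivAt (fun t => backwardFlux a α (k + 1) t x y)
      (∑ z ∈ nbrs x, btmRate a α x z *
        (-btmExitRate a α z * btmProb a α (k + 1) t z y + backwardFlux a α k t z y)) t :=
  HasDerivAt.fun_sum fun z _ => (hasDerivAt_btmProb k z y t).const_mul _

lemma hasDerivAt_forwardFlux (k : ℕ) (x y : Site d) (t : ℝ) :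
    HasDerivAt (fun t => forwardFlux a α (k + 1) t x y)
      (-btmExitRate a α x * forwardFlux a α (k + 1) t x y
        + ∑ z ∈ nbrs x, btmRate a α x z * forwardFlux a α k t z y) t := by
  refine (HasDerivAt.fun_sum fun z _ =>
    (hasDerivAt_btmProb k x z t).mul_const _).congr_deriv ?_
  have hswap : ∑ z ∈ nbrs y, backwardFlux a α k t x z * btmRate a α z y
      = ∑ z ∈ nbrs x, btmRate a α x z * forwardFlux a α k t z y := by
    simp only [backwardFlux, forwardFlux, Finset.sum_mul, Finset.mul_sum, mul_assoc]
    exact Finset.sum_comm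
  simp only [add_mul, Finset.sum_add_distrib, hswap, forwardFlux, Finset.mul_sum, mul_assoc]

/-- The Kolmogorov forward equation, truncated by the number of jumps. Both sides are the time
derivative of `btmProb a α (k + 1) t x y`, and their difference solves a linear equation with zero
initial value. -/
lemma btmProb_forward (k : ℕ) (x y : Site d) {t : ℝ} (ht : 0 ≤ t) :
    -btmExitRate a α x * btmProb a α (k + 1) t x y + backwardFlux a α k t x y
      = -btmExitRate a α y * btmProb a α (k + 1) t x y + forwardFlux a α k t x y := by
  induction k generalizing x t with
  | zero =>
    by_cases h : x = y <;> simp [btmProb, backwardFlux, forwardFlux, h]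
  | succ k ih =>
    rw [← sub_eq_zero]
    refine eq_zero_of_hasDerivAt_linear (q := btmExitRate a α x)
      (E := fun t =>
        (-btmExitRate a α x * btmProb a α (k + 1 + 1) t x y + backwardFlux a α (k + 1) t x y)
        - (-btmExitRate a α y * btmProb a α (k + 1 + 1) t x y + forwardFlux a α (k + 1) t x y))
      (h := fun t => ∑ z ∈ nbrs x, btmRate a α x z *
        ((-btmExitRate a α z * btmProb a α (k + 1) t z y + backwardFlux a α k t z y)
        - (-btmExitRate a α y * btmProb a α (k + 1) t z y + forwardFlux a α k t z y)))
      (fun t _ => ?_) (fun t ht => ?_) ?_ ht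
    · have hp := hasDerivAt_btmProb (a := a) (α := α) (k + 1) x y t
      refine (((hp.const_mul _).add (hasDerivAt_backwardFlux k x y t)).sub
        ((hp.const_mul _).add (hasDerivAt_forwardFlux k x y t))).congr_deriv ?_
      have hfactor : ∑ z ∈ nbrs x,
          btmRate a α x z * (-btmExitRate a α y * btmProb a α (k + 1) t z y)
          = -btmExitRate a α y * backwardFlux a α (k + 1) t x y := by
        simp only [backwardFlux, Finset.mul_sum, mul_left_comm]
      simp only [mul_sub, mul_add, Finset.sum_add_distrib, Finset.sum_sub_distrib, hfactor]
      ring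
    · exact Finset.sum_eq_zero fun z _ => by rw [ih z ht, sub_self, mul_zero]
    · rw [btmProb_succ_zero, backwardFlux_succ_zero, forwardFlux_succ_zero]
      by_cases h : x = y
      · subst h
        rw [sub_self]
      · simp only [if_neg h, mul_zero, sub_self]

/-- Reversibility of the truncated transition probabilities with respect to `α`. -/
lemma env_mul_btmProb_comm (k : ℕ) (x y : Site d) {t : ℝ} (ht : 0 ≤ t) :
    (α x : ℝ) * btmProb a α k t x y = α y * btmProb a α k t y x := by
  induction k generalizing x t with
  | zero => simp [btmProb]
  | succ k ih =>
    rw [← sub_eq_zero]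
    refine eq_zero_of_hasDerivAt_linear (q := btmExitRate a α x)
      (E := fun t => (α x : ℝ) * btmProb a α (k + 1) t x y - α y * btmProb a α (k + 1) t y x)
      (h := fun t => (α x : ℝ) * backwardFlux a α k t x y - α y * forwardFlux a α k t y x)
      (fun t ht => ?_) (fun t ht => ?_) ?_ ht
    · refine (((hasDerivAt_btmProb k x y t).const_mul _).sub
        ((hasDerivAt_btmProb k y x t).const_mul _)).congr_deriv ?_
      rw [btmProb_forward k y x ht]
      ring
    · rw [sub_eq_zero, backwardFlux, forwardFlux, Finset.mul_sum, Finset.mul_sum]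
      refine Finset.sum_congr rfl fun z _ => ?_
      rw [← mul_assoc, env_mul_btmRate_comm, mul_right_comm, ih z ht, mul_assoc]
    · simp only [btmProb_succ_zero, eq_comm (a := y)]
      by_cases h : x = y <;> simp [h]

end Reversibility

section MassLoss

/-- The Laplace transform `𝐄_x[exp(-τ_k)]` of the time `τ_k` of the `k`-th jump of `BTM(a)`,
computed by conditioning on the first jump. -/
def jumpLaplace (a : ℝ) (α : Env d) : ℕ → Site d → ℝ
  | 0, _ => 1
  | k + 1, x => (∑ z ∈ nbrs x, btmRate a α x z * jumpLaplace a α k z) / (btmExitRate a α x + 1)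

lemma btmExitRate_add_one_pos (x : Site d) : 0 < btmExitRate a α x + 1 :=
  add_pos_of_nonneg_of_pos (btmExitRate_nonneg x) one_pos

lemma jumpLaplace_succ_mul (k : ℕ) (x : Site d) :
    jumpLaplace a α (k + 1) x * (btmExitRate a α x + 1)
      = ∑ z ∈ nbrs x, btmRate a α x z * jumpLaplace a α k z :=
  div_mul_cancel₀ _ (btmExitRate_add_one_pos x).ne'

lemma jumpLaplace_nonneg (k : ℕ) (x : Site d) : 0 ≤ jumpLaplace a α k x := by
  induction k generalizing x with
  | zero => exact zero_le_one
  | succ k ih =>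
    exact div_nonneg (Finset.sum_nonneg fun z _ => mul_nonneg (btmRate_nonneg _ _) (ih z))
      (btmExitRate_add_one_pos x).le

lemma jumpLaplace_succ_le (k : ℕ) (x : Site d) :
    jumpLaplace a α (k + 1) x ≤ jumpLaplace a α k x := by
  induction k generalizing x with
  | zero =>
    simp only [jumpLaplace, mul_one]
    exact (div_le_one (btmExitRate_add_one_pos x)).2 (lt_add_one _).le
  | succ k ih =>
    exact div_le_div_of_nonneg_right (Finset.sum_le_sum fun z _ =>
      mul_le_mul_of_nonneg_left (ih z) (btmRate_nonneg _ _)) (btmExitRate_add_one_pos x).le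

lemma jumpLaplace_antitone (x : Site d) : Antitone fun k => jumpLaplace a α k x :=
  antitone_nat_of_succ_le fun k => jumpLaplace_succ_le k x

lemma hasDerivAt_one_sub_sum_btmProb (k : ℕ) (x : Site d) (Λ : Finset (Site d)) (t : ℝ) :
    HasDerivAt (fun t => 1 - ∑ y ∈ Λ, btmProb a α (k + 1) t x y)
      (-btmExitRate a α x * (1 - ∑ y ∈ Λ, btmProb a α (k + 1) t x y)
        + ∑ z ∈ nbrs x, btmRate a α x z * (1 - ∑ y ∈ Λ, btmProb a α k t z y)) t := by
  refine ((HasDerivAt.fun_sum fun y _ => hasDerivAt_btmProb k x y t).const_sub 1).congr_deriv ?_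
  have hswap : ∑ y ∈ Λ, backwardFlux a α k t x y
      = ∑ z ∈ nbrs x, btmRate a α x z * ∑ y ∈ Λ, btmProb a α k t z y := by
    simp only [backwardFlux, Finset.mul_sum]
    exact Finset.sum_comm
  simp only [Finset.sum_add_distrib, ← Finset.mul_sum, hswap, mul_sub, Finset.sum_sub_distrib,
    mul_one]
  rw [show ∑ z ∈ nbrs x, btmRate a α x z = btmExitRate a α x from rfl]
  ring

lemma sum_btmProb_le_one (k : ℕ) (x : Site d) (Λ : Finset (Site d)) {t : ℝ} (ht : 0 ≤ t) :
    ∑ y ∈ Λ, btmProb a α k t x y ≤ 1 := by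
  induction k generalizing x t with
  | zero => simp [btmProb]
  | succ k ih =>
    rw [← sub_nonneg]
    refine nonneg_of_hasDerivAt_linear (fun t _ => hasDerivAt_one_sub_sum_btmProb k x Λ t)
      (fun t ht => ?_) ?_ ht
    · exact Finset.sum_nonneg fun z _ => mul_nonneg (btmRate_nonneg _ _) (sub_nonneg.2 (ih z ht))
    · simp only [btmProb_succ_zero, Finset.sum_ite_eq]
      split_ifs <;> norm_num

/-- Markov's inequality: the mass missing from `btmProb a α k t x` is the probability of `τ_k ≤ t`,
which is at most `𝐄_x[exp(t - τ_k)]`. -/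
lemma one_sub_sum_btmProb_le (k : ℕ) (x : Site d) (Λ : Finset (Site d))
    (hΛ : closedNbhd^[k] {x} ⊆ Λ) {t : ℝ} (ht : 0 ≤ t) :
    1 - ∑ y ∈ Λ, btmProb a α k t x y ≤ Real.exp t * jumpLaplace a α k x := by
  induction k generalizing x t with
  | zero => simpa [btmProb, jumpLaplace] using ht
  | succ k ih =>
    have hx : x ∈ Λ := hΛ (subset_iterate_closedNbhd _ _ (Finset.mem_singleton_self x))
    have hΛ' : ∀ z ∈ nbrs x, closedNbhd^[k] {z} ⊆ Λ := fun z hz =>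
      (iterate_closedNbhd_subset_succ (mem_closedNbhd_singleton.2 (.inr hz)) k).trans hΛ
    rw [← sub_nonneg]
    refine nonneg_of_hasDerivAt_linear (q := btmExitRate a α x)
      (E := fun t => Real.exp t * jumpLaplace a α (k + 1) x
        - (1 - ∑ y ∈ Λ, btmProb a α (k + 1) t x y))
      (h := fun t => ∑ z ∈ nbrs x, btmRate a α x z * (Real.exp t * jumpLaplace a α k z
        - (1 - ∑ y ∈ Λ, btmProb a α k t z y)))
      (fun t _ => ?_) (fun t ht => ?_) ?_ ht
    · refine (((Real.hasDerivAt_exp t).mul_const _).sub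
        (hasDerivAt_one_sub_sum_btmProb k x Λ t)).congr_deriv ?_
      have hsum : ∑ z ∈ nbrs x, btmRate a α x z * (Real.exp t * jumpLaplace a α k z)
          = Real.exp t * (jumpLaplace a α (k + 1) x * (btmExitRate a α x + 1)) := by
        simp only [jumpLaplace_succ_mul, Finset.mul_sum, mul_left_comm]
      simp only [mul_sub (btmRate a α x _) (Real.exp t * _), Finset.sum_sub_distrib, hsum]
      ring
    · exact Finset.sum_nonneg fun z hz => mul_nonneg (btmRate_nonneg _ _)
        (sub_nonneg.2 (ih z (hΛ' z hz) ht))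
    · simp only [btmProb_succ_zero, Finset.sum_ite_eq, if_pos hx]
      simpa using jumpLaplace_nonneg (k + 1) x

end MassLoss

section NonExplosion

/-- `BTM(a)` in the environment `α` does not explode: started from any site, it makes only finitely
many jumps in finite time. This is expressed by `𝐄_x[exp(-τ_k)] → 0`. -/
def NonExplosive (a : ℝ) (α : Env d) : Prop :=
  ∀ x, Tendsto (fun k => jumpLaplace a α k x) atTop (𝓝 0)

/-- The Laplace transform `𝐄_x[exp(-τ_∞)]` of the explosion time `τ_∞ = lim τ_k` of `BTM(a)`. -/
def explosionLaplace (a : ℝ) (α : Env d) (x : Site d) : ℝ := ⨅ k, jumpLaplace a α k x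

/-- Every self-avoiding nearest-neighbour path visits a site which `BTM(a)` leaves at rate at most
`K`. -/
def NoFastPath (a : ℝ) (α : Env d) (K : ℝ) : Prop :=
  ∀ γ : ℕ → Site d, Function.Injective γ → (∀ i, γ (i + 1) ∈ nbrs (γ i)) →
    ∃ i, btmExitRate a α (γ i) ≤ K

lemma tendsto_explosionLaplace (x : Site d) :
    Tendsto (fun k => jumpLaplace a α k x) atTop (𝓝 (explosionLaplace a α x)) :=
  tendsto_atTop_ciInf (jumpLaplace_antitone x)
    ⟨0, by rintro _ ⟨k, rfl⟩; exact jumpLaplace_nonneg k x⟩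

lemma explosionLaplace_nonneg (x : Site d) : 0 ≤ explosionLaplace a α x :=
  le_ciInf fun k => jumpLaplace_nonneg k x

lemma explosionLaplace_le_one (x : Site d) : explosionLaplace a α x ≤ 1 :=
  (jumpLaplace_antitone x).le_of_tendsto (tendsto_explosionLaplace x) 0

lemma explosionLaplace_mul (x : Site d) :
    explosionLaplace a α x * (btmExitRate a α x + 1)
      = ∑ z ∈ nbrs x, btmRate a α x z * explosionLaplace a α z := by
  refine tendsto_nhds_unique
    (((tendsto_explosionLaplace x).comp (tendsto_add_atTop_nat 1)).mul_const _) ?_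
  simp only [Function.comp_apply, jumpLaplace_succ_mul]
  exact tendsto_finsetSum _ fun z _ => (tendsto_explosionLaplace z).const_mul _

lemma explosionLaplace_mul_le {x : Site d} {M : ℝ}
    (hM : ∀ z ∈ nbrs x, explosionLaplace a α z ≤ M) :
    explosionLaplace a α x * (btmExitRate a α x + 1) ≤ btmExitRate a α x * M := by
  rw [explosionLaplace_mul, btmExitRate, Finset.sum_mul]
  exact Finset.sum_le_sum fun z hz => mul_le_mul_of_nonneg_left (hM z hz) (btmRate_nonneg _ _)

lemma exists_mem_nbrs_explosionLaplace_lt {x : Site d} (hx : 0 < explosionLaplace a α x) :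
    ∃ z ∈ nbrs x, explosionLaplace a α x < explosionLaplace a α z := by
  by_contra! hcon
  linarith [explosionLaplace_mul_le hcon]

/-- Moving repeatedly to a neighbour with a larger value of `explosionLaplace` traces out a
self-avoiding path. -/
lemma NoFastPath.exists_le_explosionLaplace {K : ℝ} (hK : NoFastPath a α K) {x : Site d}
    (hx : 0 < explosionLaplace a α x) :
    ∃ z, btmExitRate a α z ≤ K ∧ explosionLaplace a α x ≤ explosionLaplace a α z := by
  choose! f hf hlt using fun y : Site d => exists_mem_nbrs_explosionLaplace_lt (a := a) (α := α)
    (x := y)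
  set γ : ℕ → Site d := fun i => f^[i] x
  have hsucc : ∀ i, γ (i + 1) = f (γ i) := fun i => Function.iterate_succ_apply' f i x
  have hle : ∀ i, explosionLaplace a α x ≤ explosionLaplace a α (γ i) := by
    intro i
    induction i with
    | zero => exact le_rfl
    | succ i ih => rw [hsucc]; exact ih.trans (hlt _ (hx.trans_le ih)).le
  have hmono : StrictMono fun i => explosionLaplace a α (γ i) :=
    strictMono_nat_of_lt_succ fun i => by
      simp only [hsucc]
      exact hlt _ (hx.trans_le (hle i))
  have hinj : Function.Injective γ := .of_comp (f := explosionLaplace a α) hmono.injective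
  obtain ⟨i, hi⟩ := hK γ hinj fun i => by
    rw [hsucc]; exact hf _ (hx.trans_le (hle i))
  exact ⟨γ i, hi, hle i⟩

/-- At a site `z` left at rate at most `K`, `explosionLaplace` is at most `K / (K + 1)` times its
supremum; but such sites come arbitrarily close to the supremum. -/
lemma NoFastPath.explosionLaplace_eq_zero {K : ℝ} (hK : NoFastPath a α K) (x : Site d) :
    explosionLaplace a α x = 0 := by
  set M := ⨆ x, explosionLaplace a α x
  have hle : ∀ x, explosionLaplace a α x ≤ M :=
    le_ciSup ⟨1, by rintro _ ⟨x, rfl⟩; exact explosionLaplace_le_one x⟩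
  have hM : 0 ≤ M := (explosionLaplace_nonneg x).trans (hle x)
  by_contra hx
  have hpos : 0 < explosionLaplace a α x := (explosionLaplace_nonneg x).lt_of_ne' hx
  have hK0 : 0 ≤ K := by
    obtain ⟨z, hz, -⟩ := hK.exists_le_explosionLaplace hpos
    exact (btmExitRate_nonneg z).trans hz
  have hcontract : ∀ y, explosionLaplace a α y ≤ K / (K + 1) * M := by
    intro y
    rcases (explosionLaplace_nonneg y).eq_or_lt with hy | hy
    · rw [← hy]
      positivity
    obtain ⟨z, hz, hyz⟩ := hK.exists_le_explosionLaplace hy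
    rw [div_mul_eq_mul_div, le_div_iff₀ (by positivity)]
    nlinarith [explosionLaplace_mul_le fun w (_ : w ∈ nbrs z) => hle w, hle z]
  have : Nonempty (Site d) := ⟨x⟩
  have hMle : M ≤ K / (K + 1) * M := ciSup_le hcontract
  rw [div_mul_eq_mul_div, le_div_iff₀ (by positivity)] at hMle
  linarith [hle x]

lemma NoFastPath.nonExplosive {K : ℝ} (hK : NoFastPath a α K) : NonExplosive a α := fun x =>
  hK.explosionLaplace_eq_zero x ▸ tendsto_explosionLaplace x

end NonExplosion

section Chains

variable {T : Type*} [DecidableEq T]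

/-- The sequences `[p 1, …, p m]` with `p 0 = t` and `p (i + 1) ∈ step (p i)`. -/
def chains (step : T → Finset T) : ℕ → T → Finset (List T)
  | 0, _ => {[]}
  | m + 1, t => (step t).biUnion fun t' => (chains step m t').image (List.cons t')

lemma card_chains_le {step : T → Finset T} {D : ℕ} (h : ∀ t, (step t).card ≤ D) (m : ℕ) (t : T) :
    (chains step m t).card ≤ D ^ m := by
  induction m generalizing t with
  | zero => simp [chains]
  | succ m ih =>
    rw [chains, pow_succ']
    exact (Finset.card_biUnion_le_card_mul _ _ _ fun t' _ =>
      Finset.card_image_le.trans (ih t')).trans (Nat.mul_le_mul_right _ (h t))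

lemma map_mem_chains {step : T → Finset T} (m : ℕ) {p : ℕ → T}
    (h : ∀ i, p (i + 1) ∈ step (p i)) :
    (List.range m).map (fun i => p (i + 1)) ∈ chains step m (p 0) := by
  induction m generalizing p with
  | zero => simp [chains]
  | succ m ih =>
    rw [List.range_succ_eq_map, List.map_cons, List.map_map, chains]
    exact Finset.mem_biUnion.2 ⟨p 1, h 0, Finset.mem_image_of_mem _ (ih fun i => h (i + 1))⟩

end Chains

section DeepTraps

lemma rpow_le_rpow_abs {u v : ℝ} (hu : 1 ≤ u) (huv : u ≤ v) (b : ℝ) : u ^ b ≤ v ^ |b| :=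
  calc u ^ b ≤ u ^ |b| := Real.rpow_le_rpow_of_exponent_le hu (le_abs_self b)
    _ ≤ v ^ |b| := Real.rpow_le_rpow (zero_le_one.trans hu) huv (abs_nonneg b)

lemma btmRate_le_of_env_le {K : ℕ} {x y : Site d} (hx : (α x : ℕ) ≤ K) (hy : (α y : ℕ) ≤ K) :
    btmRate a α x y ≤ (K : ℝ) ^ |a - 1| * (K : ℝ) ^ |a| := by
  have one_le : ∀ z, (1 : ℝ) ≤ α z := fun z => by exact_mod_cast (α z).pos
  exact mul_le_mul (rpow_le_rpow_abs (one_le x) (by exact_mod_cast hx) _)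
    (rpow_le_rpow_abs (one_le y) (by exact_mod_cast hy) _)
    (Real.rpow_nonneg (env_pos α y).le _) (by positivity)

lemma exists_deep_of_lt_btmExitRate {K : ℕ} {x : Site d}
    (hx : 2 * d * ((K : ℝ) ^ |a - 1| * (K : ℝ) ^ |a|) < btmExitRate a α x) :
    ∃ y ∈ closedNbhd {x}, K < (α y : ℕ) := by
  by_contra! hcon
  refine absurd hx (not_lt.2 ?_)
  have hrate : ∀ y ∈ nbrs x, btmRate a α x y ≤ (K : ℝ) ^ |a - 1| * (K : ℝ) ^ |a| := fun y hy =>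
    btmRate_le_of_env_le (hcon x (mem_closedNbhd_singleton.2 (.inl rfl)))
      (hcon y (mem_closedNbhd_singleton.2 (.inr hy)))
  refine (Finset.sum_le_card_nsmul _ _ _ hrate).trans ?_
  rw [nsmul_eq_mul]
  gcongr
  exact_mod_cast card_nbrs_le x

/-- From `y₀` there is a chain of `m` jumps, each of graph distance at most three, which visits only
sites with `α > K`, and at least `j` different ones. -/
def HasDeepChain (α : Env d) (K m j : ℕ) (y₀ : Site d) : Prop :=
  ∃ l ∈ chains (fun y => closedNbhd^[3] {y}) m y₀,
    j ≤ l.toFinset.card ∧ ∀ y ∈ l, K < (α y : ℕ)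

/-- The sites of a fast self-avoiding path all have a deep trap within distance one, and one trap
can serve at most `2 * d + 1` of them. -/
lemma exists_hasDeepChain_of_not_noFastPath {K : ℕ}
    (hK : ¬ NoFastPath a α (2 * d * ((K : ℝ) ^ |a - 1| * (K : ℝ) ^ |a|))) :
    ∃ y₀, ∀ j, HasDeepChain α K ((2 * d + 1) * j) j y₀ := by
  simp only [NoFastPath, not_forall, not_exists, not_le] at hK
  obtain ⟨γ, hinj, hγ, hfast⟩ := hK
  choose y hy hyK using fun i => exists_deep_of_lt_btmExitRate (hfast i)
  have hstep : ∀ i, y (i + 1) ∈ closedNbhd^[3] {y i} := fun i =>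
    iterate_closedNbhd_subset_succ (mem_closedNbhd_singleton_comm.1 (hy i)) 2
      (iterate_closedNbhd_subset_succ (mem_closedNbhd_singleton.2 (.inr (hγ i))) 1 (hy (i + 1)))
  refine ⟨y 0, fun j => ⟨_, map_mem_chains _ hstep, ?_, fun z hz => ?_⟩⟩
  · set Y := ((List.range ((2 * d + 1) * j)).map fun i => y (i + 1)).toFinset with hY
    have hsub : (Finset.range ((2 * d + 1) * j)).image (fun i => γ (i + 1)) ⊆ closedNbhd Y := by
      intro x hx
      obtain ⟨i, hi, rfl⟩ := Finset.mem_image.1 hx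
      have hyY : y (i + 1) ∈ Y := by
        rw [hY, List.mem_toFinset]
        exact List.mem_map_of_mem (List.mem_range.2 (Finset.mem_range.1 hi))
      exact closedNbhd_mono (Finset.singleton_subset_iff.2 hyY)
        (mem_closedNbhd_singleton_comm.1 (hy (i + 1)))
    have hcard := (Finset.card_le_card hsub).trans (card_closedNbhd_le Y)
    rw [Finset.card_image_of_injective _ fun i j h => Nat.succ_injective (hinj h),
      Finset.card_range, mul_comm] at hcard
    exact Nat.le_of_mul_le_mul_right hcard (Nat.succ_pos _)
  · obtain ⟨i, -, rfl⟩ := List.mem_map.1 hz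
    exact hyK _

end DeepTraps

section RandomEnvironment

variable (ν : Measure ℕ+) [IsProbabilityMeasure ν]

lemma tendsto_measure_lt_coe_atTop (μ : Measure ℕ+) [IsFiniteMeasure μ] :
    Tendsto (fun K : ℕ => μ {k : ℕ+ | K < (k : ℕ)}) atTop (𝓝 0) := by
  have hempty : (⋂ K : ℕ, {k : ℕ+ | K < (k : ℕ)}) = ∅ :=
    Set.eq_empty_of_forall_notMem fun k hk => lt_irrefl (k : ℕ) (Set.mem_iInter.1 hk k)
  have htendsto := tendsto_measure_iInter_atTop (μ := μ) (s := fun K : ℕ => {k : ℕ+ | K < (k : ℕ)})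
    (fun _ => MeasurableSet.of_discrete.nullMeasurableSet)
    (fun K L hKL k hk => lt_of_le_of_lt hKL hk) ⟨0, measure_ne_top _ _⟩
  rwa [hempty, measure_empty] at htendsto

lemma envLaw_forall_mem_lt (K : ℕ) (F : Finset (Site d)) :
    envLaw d ν {α | ∀ y ∈ F, K < (α y : ℕ)} = ν {k | K < (k : ℕ)} ^ F.card := by
  have hpi : {α : Env d | ∀ y ∈ F, K < (α y : ℕ)}
      = Set.pi (F : Set (Site d)) fun _ => {k : ℕ+ | K < (k : ℕ)} := rfl
  rw [hpi, envLaw, Measure.infinitePi_pi _ fun _ _ => MeasurableSet.of_discrete,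
    Finset.prod_const]

lemma envLaw_hasDeepChain_le (K m j : ℕ) (y₀ : Site d) :
    envLaw d ν {α | HasDeepChain α K m j y₀}
      ≤ (((2 * d + 1) ^ 3) ^ m : ℕ) * ν {k | K < (k : ℕ)} ^ j := by
  set C := (chains (fun y => closedNbhd^[3] {y}) m y₀).filter fun l => j ≤ l.toFinset.card
  have hsub : {α : Env d | HasDeepChain α K m j y₀}
      ⊆ ⋃ l ∈ C, {α | ∀ y ∈ l.toFinset, K < (α y : ℕ)} := by
    rintro α ⟨l, hl, hj, hlK⟩
    exact Set.mem_iUnion₂.2 ⟨l, Finset.mem_filter.2 ⟨hl, hj⟩, fun y hy =>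
      hlK y (List.mem_toFinset.1 hy)⟩
  calc envLaw d ν {α | HasDeepChain α K m j y₀}
      ≤ ∑ l ∈ C, envLaw d ν {α | ∀ y ∈ l.toFinset, K < (α y : ℕ)} :=
        (measure_mono hsub).trans (measure_biUnion_finset_le _ _)
    _ ≤ ∑ _ ∈ C, ν {k | K < (k : ℕ)} ^ j := by
        refine Finset.sum_le_sum fun _ hl => ?_
        rw [envLaw_forall_mem_lt]
        exact pow_le_pow_right_of_le_one' prob_le_one (Finset.mem_filter.1 hl).2
    _ ≤ (((2 * d + 1) ^ 3) ^ m : ℕ) * ν {k | K < (k : ℕ)} ^ j := by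
        rw [Finset.sum_const, nsmul_eq_mul]
        gcongr
        exact (Finset.card_filter_le _ _).trans
          (card_chains_le (card_iterate_closedNbhd_singleton_le 3) _ _)

lemma ae_not_forall_hasDeepChain {K c : ℕ}
    (hK : (((2 * d + 1) ^ 3) ^ c : ℕ) * ν {k | K < (k : ℕ)} < 1) :
    ∀ᵐ α ∂(envLaw d ν), ∀ y₀, ¬ ∀ j, HasDeepChain α K (c * j) j y₀ := by
  refine ae_all_iff.2 fun y₀ => measure_eq_zero_iff_ae_notMem.1 ?_
  have hle : ∀ j, envLaw d ν {α | ∀ j, HasDeepChain α K (c * j) j y₀}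
      ≤ ((((2 * d + 1) ^ 3) ^ c : ℕ) * ν {k | K < (k : ℕ)}) ^ j := fun j =>
    calc envLaw d ν {α | ∀ j, HasDeepChain α K (c * j) j y₀}
        ≤ envLaw d ν {α | HasDeepChain α K (c * j) j y₀} := measure_mono fun α hα => hα j
      _ ≤ _ := envLaw_hasDeepChain_le ν K (c * j) j y₀
      _ = _ := by rw [mul_pow, pow_mul]; push_cast; rfl
  exact le_antisymm (ge_of_tendsto' (ENNReal.tendsto_pow_atTop_nhds_zero_of_lt_one hK) hle) zero_le

/-- A Peierls argument: for large `K` the traps deeper than `K` do not percolate, not even with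
jumps of length three. -/
lemma ae_nonExplosive (d : ℕ) (a : ℝ) : ∀ᵐ α ∂(envLaw d ν), NonExplosive a α := by
  obtain ⟨K, hK⟩ : ∃ K : ℕ,
      (((2 * d + 1) ^ 3) ^ (2 * d + 1) : ℕ) * ν {k : ℕ+ | K < (k : ℕ)} < 1 := by
    have hlim := ENNReal.Tendsto.const_mul (tendsto_measure_lt_coe_atTop ν)
      (a := (((2 * d + 1) ^ 3) ^ (2 * d + 1) : ℕ)) (.inr (ENNReal.natCast_ne_top _))
    rw [mul_zero] at hlim
    exact (hlim.eventually (gt_mem_nhds one_pos)).exists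
  filter_upwards [ae_not_forall_hasDeepChain ν hK] with α hα
  by_contra hexp
  obtain ⟨y₀, hy₀⟩ := exists_hasDeepChain_of_not_noFastPath (K := K) fun h => hexp h.nonExplosive
  exact hα y₀ hy₀

end RandomEnvironment

section Exclusion

/-- The generator of `BTM(a)`. -/
def btmGen (a : ℝ) (α : Env d) (g : Site d → ℝ) (x : Site d) : ℝ :=
  ∑ y ∈ nbrs x, btmRate a α x y * (g y - g x)

/-- The carré du champ `A(g²) - 2 g A g` of the generator `A` of `BTM(a)`. -/
def btmCarre (a : ℝ) (α : Env d) (g : Site d → ℝ) (x : Site d) : ℝ :=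
  ∑ y ∈ nbrs x, btmRate a α x y * (g y - g x) ^ 2

/-- The rate at which the exclusion process in the configuration `η` moves a particle from `x`
to `y`. -/
def exclRate (a : ℝ) (α : Env d) (η : Config α) (x y : Site d) : ℝ :=
  ((η x : ℕ) : ℝ) * (α x : ℝ) ^ (a - 1) * ((α y : ℝ) ^ a * (1 - ((η y : ℕ) : ℝ) / (α y : ℝ)))

lemma config_le (η : Config α) (x : Site d) : ((η x : ℕ) : ℝ) ≤ α x := by
  exact_mod_cast Nat.lt_succ_iff.1 (η x).isLt

/-- The exclusion interaction is symmetric in `x` and `y`. -/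
lemma exclRate_eq (η : Config α) (x y : Site d) :
    exclRate a α η x y = ((η x : ℕ) : ℝ) * btmRate a α x y
      - ((η x : ℕ) : ℝ) * ((η y : ℕ) : ℝ) * ((α x : ℝ) ^ (a - 1) * (α y : ℝ) ^ (a - 1)) := by
  rw [exclRate, btmRate, Real.rpow_sub_one (env_pos α y).ne']
  ring

lemma exclRate_le (η : Config α) (x y : Site d) :
    exclRate a α η x y ≤ ((η x : ℕ) : ℝ) * btmRate a α x y := by
  rw [exclRate_eq, sub_le_self_iff]
  exact mul_nonneg (by positivity) (mul_nonneg (Real.rpow_nonneg (env_pos α x).le _)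
    (Real.rpow_nonneg (env_pos α y).le _))

lemma move_apply (η : Config α) (x y z : Site d) :
    (move η x y z : ℕ) = if 0 < (η x : ℕ) ∧ (η y : ℕ) < (α y : ℕ) then
      (if z = y then (η y : ℕ) + 1 else if z = x then (η x : ℕ) - 1 else η z) else η z := by
  unfold move
  by_cases h : 0 < (η x : ℕ) ∧ (η y : ℕ) < (α y : ℕ)
  · simp only [h, and_self, dif_pos, if_true]
    by_cases hy : z = y
    · subst hy; simp
    · by_cases hx : z = x
      · subst hx; simp [hy]
      · simp [hy, hx]
  · rw [dif_neg h, if_neg h]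

lemma move_apply_of_ne {x y z : Site d} (η : Config α) (hx : z ≠ x) (hy : z ≠ y) :
    move η x y z = η z :=
  Fin.ext (by simp [move_apply, hx, hy])

lemma exclRate_eq_zero_or_move (η : Config α) {x y : Site d} (hxy : x ≠ y) :
    exclRate a α η x y = 0 ∨ ∀ z, ((move η x y z : ℕ) : ℝ) =
      ((η z : ℕ) : ℝ) + ((if z = y then 1 else 0) - (if z = x then 1 else 0)) := by
  by_cases hx : (η x : ℕ) = 0
  · left; simp [exclRate, hx]
  by_cases hy : (η y : ℕ) < (α y : ℕ)
  · right
    intro z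
    rw [move_apply, if_pos ⟨Nat.pos_of_ne_zero hx, hy⟩]
    by_cases hzy : z = y
    · subst hzy; simp [hxy.symm]
    · by_cases hzx : z = x
      · subst hzx
        rw [if_neg hzy, if_pos rfl, if_neg hzy, if_pos rfl, Nat.cast_sub (Nat.pos_of_ne_zero hx)]
        push_cast
        ring
      · simp [hzy, hzx]
  · left
    have hfull : (η y : ℕ) = α y := le_antisymm (Nat.lt_succ_iff.1 (η y).isLt) (not_lt.1 hy)
    rw [exclRate, hfull, div_self (env_pos α y).ne', sub_self, mul_zero, mul_zero]

end Exclusion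

section LocalFunctions

lemma isLocal_const (c : ℝ) : IsLocal fun _ : Config α => c :=
  ⟨∅, fun _ _ _ => rfl⟩

lemma isLocal_coord (x : Site d) : IsLocal fun η : Config α => ((η x : ℕ) : ℝ) :=
  ⟨{x}, fun η ζ h => by simp [h x]⟩

lemma IsLocal.comp₂ {φ ψ : Config α → ℝ} (F : ℝ → ℝ → ℝ) (hφ : IsLocal φ) (hψ : IsLocal ψ) :
    IsLocal fun η => F (φ η) (ψ η) := by
  obtain ⟨S, hS⟩ := hφ
  obtain ⟨T, hT⟩ := hψ
  exact ⟨S ∪ T, fun η ζ h => congrArg₂ F (hS fun x hx => h x (Finset.mem_union_left _ hx))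
    (hT fun x hx => h x (Finset.mem_union_right _ hx))⟩

lemma IsLocal.add {φ ψ : Config α → ℝ} (hφ : IsLocal φ) (hψ : IsLocal ψ) :
    IsLocal fun η => φ η + ψ η :=
  hφ.comp₂ (· + ·) hψ

lemma IsLocal.mul {φ ψ : Config α → ℝ} (hφ : IsLocal φ) (hψ : IsLocal ψ) :
    IsLocal fun η => φ η * ψ η :=
  hφ.comp₂ (· * ·) hψ

lemma IsLocal.exists_factor {φ : Config α → ℝ} (hφ : IsLocal φ) :
    ∃ (S : Finset (Site d)) (ψ : (∀ x : S, Fin ((α x : ℕ) + 1)) → ℝ),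
      φ = fun η => ψ fun x => η x := by
  obtain ⟨S, hS⟩ := hφ
  obtain ⟨ψ, hψ⟩ := (Function.factorsThrough_iff φ).1 (dependsOn_iff_factorsThrough.1 hS)
  exact ⟨S, ψ, hψ⟩

lemma IsLocal.measurable {φ : Config α → ℝ} (hφ : IsLocal φ) : Measurable φ := by
  obtain ⟨S, ψ, rfl⟩ := hφ.exists_factor
  exact (measurable_of_countable ψ).comp (measurable_pi_lambda _ fun x => measurable_pi_apply _)

lemma IsLocal.exists_bound {φ : Config α → ℝ} (hφ : IsLocal φ) : ∃ C, ∀ η, ‖φ η‖ ≤ C := by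
  obtain ⟨S, ψ, rfl⟩ := hφ.exists_factor
  obtain ⟨C, hC⟩ := (Set.finite_range fun i => ‖ψ i‖).bddAbove
  exact ⟨C, fun η => hC ⟨_, rfl⟩⟩

lemma exclGen_eq_sum {φ : Config α → ℝ} {S : Finset (Site d)}
    (hφ : DependsOn φ (S : Set (Site d))) (η : Config α) :
    exclGen a α φ η
      = ∑ x ∈ closedNbhd S, ∑ y ∈ nbrs x, exclRate a α η x y * (φ (move η x y) - φ η) := by
  refine tsum_eq_sum fun x hx => Finset.sum_eq_zero fun y hy => ?_
  have hxS : x ∉ S := fun h => hx (subset_closedNbhd S h)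
  have hyS : y ∉ S := fun h => hx (mem_closedNbhd_of_mem_nbrs h (mem_nbrs_comm.1 hy))
  rw [hφ (x := move η x y) (y := η) fun z hz =>
    move_apply_of_ne η (fun h => hxS (h ▸ hz)) (fun h => hyS (h ▸ hz)), sub_self, mul_zero]

lemma IsLocal.exclGen {φ : Config α → ℝ} (hφ : IsLocal φ) : IsLocal (exclGen a α φ) := by
  obtain ⟨S, hS⟩ := hφ
  refine ⟨closedNbhd (closedNbhd S), fun η ζ h => ?_⟩
  have hSη : ∀ z ∈ S, η z = ζ z := fun z hz => h z (subset_closedNbhd _ (subset_closedNbhd _ hz))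
  rw [exclGen_eq_sum hS, exclGen_eq_sum hS]
  refine Finset.sum_congr rfl fun x hx => Finset.sum_congr rfl fun y hy => ?_
  have hx' := h x (subset_closedNbhd _ hx)
  have hy' := h y (mem_closedNbhd_of_mem_nbrs hx hy)
  have hmove : φ (move η x y) = φ (move ζ x y) := hS fun z hz => Fin.ext <| by
    rw [move_apply, move_apply, hx', hy', hSη z hz]
  rw [hS hSη, hmove, exclRate, exclRate, hx', hy']

lemma exclGen_sum {ι : Type*} (I : Finset ι) (c : ι → ℝ) {φ : ι → Config α → ℝ}
    (hφ : ∀ i, IsLocal (φ i)) (η : Config α) :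
    exclGen a α (fun ζ => ∑ i ∈ I, c i * φ i ζ) η = ∑ i ∈ I, c i * exclGen a α (φ i) η := by
  classical
  choose S hS using hφ
  have hdep : ∀ i ∈ I, DependsOn (φ i) (I.biUnion S : Set (Site d)) := fun i hi η ζ h =>
    hS i fun z hz => h z (Finset.mem_biUnion.2 ⟨i, hi, hz⟩)
  have hdep_sum : DependsOn (fun ζ => ∑ i ∈ I, c i * φ i ζ) (I.biUnion S : Set (Site d)) :=
    fun η ζ h => Finset.sum_congr rfl fun i hi => by rw [hdep i hi h]
  have hgen : ∀ i ∈ I, c i * exclGen a α (φ i) η = c i * ∑ x ∈ closedNbhd (I.biUnion S),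
      ∑ y ∈ nbrs x, exclRate a α η x y * (φ i (move η x y) - φ i η) := fun i hi => by
    rw [exclGen_eq_sum (hdep i hi) η]
  rw [exclGen_eq_sum hdep_sum, Finset.sum_congr rfl hgen]
  simp only [Finset.mul_sum, ← Finset.sum_sub_distrib]
  rw [Finset.sum_comm]
  refine Finset.sum_congr rfl fun x _ => ?_
  rw [Finset.sum_comm]
  exact Finset.sum_congr rfl fun y _ => Finset.sum_congr rfl fun i _ => by ring

end LocalFunctions

section LinearFunctionals

/-- The linear functional `∑_{x ∈ Λ} g(x) η(x)` of the configuration `η`. -/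
def pairing (Λ : Finset (Site d)) (g : Site d → ℝ) (η : Config α) : ℝ :=
  ∑ x ∈ Λ, g x * ((η x : ℕ) : ℝ)

lemma dependsOn_pairing (Λ : Finset (Site d)) (g : Site d → ℝ) :
    DependsOn (pairing (α := α) Λ g) (Λ : Set (Site d)) := fun η ζ h =>
  Finset.sum_congr rfl fun x hx => by rw [h x hx]

lemma isLocal_pairing (Λ : Finset (Site d)) (g : Site d → ℝ) : IsLocal (pairing (α := α) Λ g) :=
  ⟨Λ, dependsOn_pairing Λ g⟩

lemma isLocal_pairing_sq (Λ : Finset (Site d)) (g : Site d → ℝ) :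
    IsLocal fun η => pairing (α := α) Λ g η ^ 2 := by
  simpa only [pow_two] using (isLocal_pairing Λ g).mul (isLocal_pairing Λ g)

lemma pairing_nonneg {Λ : Finset (Site d)} {g : Site d → ℝ} (hg : ∀ x, 0 ≤ g x) (η : Config α) :
    0 ≤ pairing Λ g η :=
  Finset.sum_nonneg fun x _ => mul_nonneg (hg x) (Nat.cast_nonneg _)

lemma pairing_mono {Λ : Finset (Site d)} {g h : Site d → ℝ} (hgh : ∀ x ∈ Λ, g x ≤ h x)
    (η : Config α) : pairing Λ g η ≤ pairing Λ h η :=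
  Finset.sum_le_sum fun x hx => mul_le_mul_of_nonneg_right (hgh x hx) (Nat.cast_nonneg _)

lemma pairing_le {Λ : Finset (Site d)} {g : Site d → ℝ} (hg : ∀ x, 0 ≤ g x) (η : Config α) :
    pairing Λ g η ≤ ∑ x ∈ Λ, g x * α x :=
  Finset.sum_le_sum fun x _ => mul_le_mul_of_nonneg_left (config_le η x) (hg x)

lemma exclRate_mul_move {Λ : Finset (Site d)} {g : Site d → ℝ} (hg : ∀ x ∉ Λ, g x = 0)
    (F : ℝ → ℝ) (η : Config α) {x y : Site d} (hy : y ∈ nbrs x) :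
    exclRate a α η x y * (F (pairing Λ g (move η x y)) - F (pairing Λ g η))
      = exclRate a α η x y * (F (pairing Λ g η + (g y - g x)) - F (pairing Λ g η)) := by
  obtain h | h := exclRate_eq_zero_or_move (a := a) η (ne_of_mem_nbrs hy)
  · simp [h]
  · have hite : ∀ x, (if x ∈ Λ then g x else 0) = g x := fun x =>
      ite_eq_left_iff.2 fun hx => (hg x hx).symm
    have hmove : pairing Λ g (move η x y) = pairing Λ g η + (g y - g x) := by
      simp only [pairing, h, mul_add, mul_sub, Finset.sum_add_distrib, Finset.sum_sub_distrib,
        mul_ite, mul_one, mul_zero, Finset.sum_ite_eq', hite]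
    rw [hmove]

lemma sum_nbrs_eq_zero_of_antisymm {Λ : Finset (Site d)} {A : Site d → Site d → ℝ}
    (hA : ∀ x y, A y x = -A x y) (h0 : ∀ x y, x ∉ Λ → y ∉ Λ → A x y = 0) :
    ∑ x ∈ closedNbhd Λ, ∑ y ∈ nbrs x, A x y = 0 := by
  have hrestrict : ∀ x, ∑ y ∈ nbrs x, A x y
      = ∑ y ∈ closedNbhd Λ, if y ∈ nbrs x then A x y else 0 := by
    intro x
    rw [← Finset.sum_filter, Finset.filter_mem_eq_inter, Finset.inter_comm]
    refine (Finset.sum_subset Finset.inter_subset_left fun y hy hy' => ?_).symm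
    have hyΛ : y ∉ closedNbhd Λ := fun h => hy' (Finset.mem_inter.2 ⟨hy, h⟩)
    exact h0 x y (fun h => hyΛ (mem_closedNbhd_of_mem_nbrs h hy))
      fun h => hyΛ (subset_closedNbhd _ h)
  simp only [hrestrict]
  refine self_eq_neg.1 ?_
  conv_lhs => rw [Finset.sum_comm]
  simp only [← Finset.sum_neg_distrib]
  refine Finset.sum_congr rfl fun x _ => Finset.sum_congr rfl fun y _ => ?_
  simp only [mem_nbrs_comm (x := y) (y := x), hA x y]
  split_ifs <;> simp

lemma sum_exclRate_mul_sub {Λ : Finset (Site d)} {g : Site d → ℝ} (hg : ∀ x ∉ Λ, g x = 0)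
    (η : Config α) :
    ∑ x ∈ closedNbhd Λ, ∑ y ∈ nbrs x, exclRate a α η x y * (g y - g x)
      = pairing (closedNbhd Λ) (btmGen a α g) η := by
  have hcancel := sum_nbrs_eq_zero_of_antisymm (Λ := Λ) (A := fun x y =>
    ((η x : ℕ) : ℝ) * ((η y : ℕ) : ℝ) * ((α x : ℝ) ^ (a - 1) * (α y : ℝ) ^ (a - 1))
      * (g y - g x)) (fun x y => by ring)
    (fun x y hx hy => by rw [hg x hx, hg y hy, sub_self, mul_zero])
  simp only [exclRate_eq, sub_mul _ _ (g _ - g _), Finset.sum_sub_distrib] at hcancel ⊢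
  rw [hcancel, sub_zero, pairing]
  refine Finset.sum_congr rfl fun x _ => ?_
  rw [btmGen, Finset.sum_mul]
  exact Finset.sum_congr rfl fun y _ => by ring

/-- The exclusion interaction cancels on linear functionals. -/
lemma exclGen_pairing {Λ : Finset (Site d)} {g : Site d → ℝ} (hg : ∀ x ∉ Λ, g x = 0)
    (η : Config α) :
    exclGen a α (pairing Λ g) η = pairing (closedNbhd Λ) (btmGen a α g) η := by
  rw [exclGen_eq_sum (dependsOn_pairing Λ g), ← sum_exclRate_mul_sub hg]
  refine Finset.sum_congr rfl fun x _ => Finset.sum_congr rfl fun y hy => ?_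
  rw [exclRate_mul_move hg (fun u => u) η hy]
  ring

/-- On squares of linear functionals the exclusion interaction only lowers the carré du champ. -/
lemma exclGen_pairing_sq_le {Λ : Finset (Site d)} {g : Site d → ℝ} (hg : ∀ x ∉ Λ, g x = 0)
    (η : Config α) :
    exclGen a α (fun ζ => pairing Λ g ζ ^ 2) η
      ≤ 2 * pairing Λ g η * exclGen a α (pairing Λ g) η
        + pairing (closedNbhd Λ) (btmCarre a α g) η := by
  have hdep : DependsOn (fun ζ => pairing (α := α) Λ g ζ ^ 2) (Λ : Set (Site d)) :=
    fun _ _ h => congrArg (· ^ 2) (dependsOn_pairing Λ g h)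
  have hcarre : pairing (closedNbhd Λ) (btmCarre a α g) η = ∑ x ∈ closedNbhd Λ, ∑ y ∈ nbrs x,
      ((η x : ℕ) : ℝ) * btmRate a α x y * (g y - g x) ^ 2 := by
    simp only [pairing, btmCarre, Finset.sum_mul]
    exact Finset.sum_congr rfl fun x _ => Finset.sum_congr rfl fun y _ => by ring
  rw [exclGen_eq_sum hdep, exclGen_pairing hg, ← sum_exclRate_mul_sub hg, hcarre]
  simp only [Finset.mul_sum, ← Finset.sum_add_distrib]
  refine Finset.sum_le_sum fun x _ => Finset.sum_le_sum fun y hy => ?_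
  rw [exclRate_mul_move hg (fun u => u ^ 2) η hy]
  have hle := mul_le_mul_of_nonneg_right (exclRate_le (a := a) η x y) (sq_nonneg (g y - g x))
  linarith

end LinearFunctionals

section Dynamics

variable {η : Config α} {Ω : Type*} {mΩ : MeasurableSpace Ω} {P : Measure Ω}
  {ξ : ℝ≥0 → Ω → Config α}

lemma tendsto_floor_mul_add_one_div (s : ℝ≥0) :
    Tendsto (fun n : ℕ => ((⌊((n : ℝ≥0) + 1) * s⌋₊ : ℝ≥0) + 1) / ((n : ℝ≥0) + 1)) atTop
      (𝓝[≥] s) := by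
  have hle : ∀ n : ℕ, s ≤ ((⌊((n : ℝ≥0) + 1) * s⌋₊ : ℝ≥0) + 1) / ((n : ℝ≥0) + 1) := fun n => by
    rw [le_div_iff₀ (by positivity), mul_comm]
    exact (Nat.lt_floor_add_one _).le
  have hge : ∀ n : ℕ, ((⌊((n : ℝ≥0) + 1) * s⌋₊ : ℝ≥0) + 1) / ((n : ℝ≥0) + 1)
      ≤ s + 1 / ((n : ℝ≥0) + 1) := fun n => by
    rw [add_div]
    gcongr
    rw [div_le_iff₀ (by positivity), mul_comm s]
    exact Nat.floor_le zero_le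
  refine tendsto_nhdsWithin_iff.2 ⟨?_, Eventually.of_forall hle⟩
  refine tendsto_of_tendsto_of_tendsto_of_le_of_le tendsto_const_nhds ?_ hle hge
  simpa using tendsto_const_nhds.add (tendsto_one_div_add_atTop_nhds_zero_nat (𝕜 := ℝ≥0))

lemma IsExclusionProcess.measurable (h : IsExclusionProcess a α η P ξ) (t : ℝ≥0) :
    Measurable (ξ t) := by
  obtain ⟨ℱ, hℱ, -⟩ := h.martingale_problem
  exact (hℱ t).mono (ℱ.le t) le_rfl

/-- By right-continuity the process is the limit of its values along the times
`(⌊(n + 1) s⌋ + 1) / (n + 1)`, which decrease to `s`. -/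
lemma IsExclusionProcess.measurable_uncurry (h : IsExclusionProcess a α η P ξ) :
    Measurable (Function.uncurry ξ) := by
  have hgrid : ∀ n : ℕ, Measurable fun p : ℕ × Ω => ξ (((p.1 : ℝ≥0) + 1) / ((n : ℝ≥0) + 1)) p.2 :=
    fun n => measurable_from_prod_countable_right fun k =>
      h.measurable (((k : ℝ≥0) + 1) / ((n : ℝ≥0) + 1))
  have hfloor : ∀ n : ℕ, Measurable fun p : ℝ≥0 × Ω => (⌊((n : ℝ≥0) + 1) * p.1⌋₊, p.2) :=
    fun n => (Nat.measurable_floor.comp (measurable_fst.const_mul _)).prodMk measurable_snd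
  exact measurable_of_tendsto_metrizable (fun n => (hgrid n).comp (hfloor n))
    (tendsto_pi_nhds.2 fun p =>
      (h.right_continuous p.2 p.1).tendsto.comp (tendsto_floor_mul_add_one_div p.1))

lemma IsExclusionProcess.measurable_comp_toNNReal (h : IsExclusionProcess a α η P ξ)
    {φ : Config α → ℝ} (hφ : IsLocal φ) :
    Measurable fun p : ℝ × Ω => φ (ξ p.1.toNNReal p.2) :=
  hφ.measurable.comp (h.measurable_uncurry.comp
    ((measurable_real_toNNReal.comp measurable_fst).prodMk measurable_snd))

/-- The expectation of `φ` at time `s`, with negative times read as time `0`. -/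
def expect (P : Measure Ω) (ξ : ℝ≥0 → Ω → Config α) (φ : Config α → ℝ) (s : ℝ) : ℝ :=
  ∫ ω, φ (ξ s.toNNReal ω) ∂P

variable [IsProbabilityMeasure P]

lemma IsExclusionProcess.integrable (h : IsExclusionProcess a α η P ξ) {φ : Config α → ℝ}
    (hφ : IsLocal φ) (t : ℝ≥0) : Integrable (fun ω => φ (ξ t ω)) P := by
  obtain ⟨C, hC⟩ := hφ.exists_bound
  exact .of_bound (hφ.measurable.comp (h.measurable t)).aestronglyMeasurable C
    (ae_of_all _ fun ω => hC _)

lemma IsExclusionProcess.expect_zero (h : IsExclusionProcess a α η P ξ) (φ : Config α → ℝ) :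
    expect P ξ φ 0 = φ η := by
  have hinitial : ∀ᵐ ω ∂P, φ (ξ (0 : ℝ).toNNReal ω) = φ η := by
    rw [Real.toNNReal_zero]
    exact h.initial.mono fun ω hω => congrArg φ hω
  rw [expect, integral_congr_ae hinitial, integral_const, probReal_univ, one_smul]

lemma IsExclusionProcess.stronglyMeasurable_expect (h : IsExclusionProcess a α η P ξ)
    {φ : Config α → ℝ} (hφ : IsLocal φ) : StronglyMeasurable (expect P ξ φ) :=
  (h.measurable_comp_toNNReal hφ).stronglyMeasurable.integral_prod_right

lemma IsExclusionProcess.intervalIntegrable_expect (h : IsExclusionProcess a α η P ξ)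
    {φ : Config α → ℝ} (hφ : IsLocal φ) (s t : ℝ) :
    IntervalIntegrable (expect P ξ φ) volume s t := by
  obtain ⟨C, hC⟩ := hφ.exists_bound
  refine (intervalIntegrable_const (c := C)).mono_fun
    (h.stronglyMeasurable_expect hφ).aestronglyMeasurable (ae_of_all _ fun s => ?_)
  refine (norm_integral_le_of_norm_le_const (ae_of_all _ fun ω => hC _)).trans ?_
  simpa using le_abs_self C

/-- Dynkin's formula. -/
lemma IsExclusionProcess.expect_eq (h : IsExclusionProcess a α η P ξ) {φ : Config α → ℝ}
    (hφ : IsLocal φ) {t : ℝ} (ht : 0 ≤ t) :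
    expect P ξ φ t = φ η + ∫ s in (0 : ℝ)..t, expect P ξ (exclGen a α φ) s := by
  obtain ⟨ℱ, -, hmartingale⟩ := h.martingale_problem
  obtain ⟨C, hC⟩ := (hφ.exclGen (a := a)).exists_bound
  lift t to ℝ≥0 using ht
  have hjoint : Integrable (Function.uncurry fun (s : ℝ) ω => exclGen a α φ (ξ s.toNNReal ω))
      ((volume.restrict (Set.Ioc 0 (t : ℝ))).prod P) :=
    .of_bound (h.measurable_comp_toNNReal hφ.exclGen).aestronglyMeasurable C
      (ae_of_all _ fun p => hC _)
  have hcentred : ∫ ω, (φ (ξ t ω) - φ (ξ 0 ω)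
      - ∫ s in (0 : ℝ)..t, exclGen a α φ (ξ s.toNNReal ω)) ∂P = 0 := by
    rw [← integral_condExp (ℱ.le 0), integral_congr_ae ((hmartingale φ hφ).2 0 t zero_le)]
    simp
  simp only [intervalIntegral.integral_of_le t.coe_nonneg] at hcentred ⊢
  have hdiff : Integrable (fun ω => φ (ξ t ω) - φ (ξ 0 ω)) P :=
    (h.integrable hφ t).sub (h.integrable hφ 0)
  have hint : Integrable (fun ω => ∫ s in Set.Ioc 0 (t : ℝ),
      exclGen a α φ (ξ s.toNNReal ω)) P := hjoint.integral_prod_right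
  rw [integral_sub hdiff hint, integral_sub (h.integrable hφ t) (h.integrable hφ 0),
    ← integral_integral_swap hjoint] at hcentred
  have hinitial := h.expect_zero φ
  simp only [expect, Real.toNNReal_zero, Real.toNNReal_coe] at hinitial ⊢
  linarith

lemma IsExclusionProcess.continuous_expect (h : IsExclusionProcess a α η P ξ) {φ : Config α → ℝ}
    (hφ : IsLocal φ) : Continuous (expect P ξ φ) := by
  have hprimitive := intervalIntegral.continuous_primitive
    (h.intervalIntegrable_expect (hφ.exclGen (a := a))) 0
  have heq : expect P ξ φ = fun t => φ η + ∫ s in (0 : ℝ)..(max t 0),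
      expect P ξ (exclGen a α φ) s := by
    funext t
    have hclamp : (max t 0).toNNReal = t.toNNReal := by simp [Real.toNNReal]
    rw [← h.expect_eq hφ (le_max_right t 0), expect, expect, hclamp]
  rw [heq]
  exact continuous_const.add (hprimitive.comp (continuous_id.max continuous_const))

lemma IsExclusionProcess.hasDerivAt_expect (h : IsExclusionProcess a α η P ξ) {φ : Config α → ℝ}
    (hφ : IsLocal φ) {t : ℝ} (ht : 0 < t) :
    HasDerivAt (expect P ξ φ) (expect P ξ (exclGen a α φ) t) t := by
  have hcont := h.continuous_expect (hφ.exclGen (a := a))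
  refine ((intervalIntegral.integral_hasDerivAt_right (hcont.intervalIntegrable 0 t)
    (hcont.stronglyMeasurableAtFilter _ _) hcont.continuousAt).const_add
      (φ η)).congr_of_eventuallyEq ?_
  filter_upwards [lt_mem_nhds ht] with s hs using h.expect_eq hφ hs.le

lemma IsExclusionProcess.expect_sum (h : IsExclusionProcess a α η P ξ) {ι : Type*} (I : Finset ι)
    {φ : ι → Config α → ℝ} (hφ : ∀ i, IsLocal (φ i)) (c : ι → ℝ) (s : ℝ) :
    expect P ξ (fun ζ => ∑ i ∈ I, c i * φ i ζ) s = ∑ i ∈ I, c i * expect P ξ (φ i) s := by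
  simp only [expect]
  rw [integral_finsetSum _ fun i _ => (h.integrable (hφ i) _).const_mul _]
  simp only [integral_const_mul]

lemma IsExclusionProcess.hasDerivAt_expect_sum (h : IsExclusionProcess a α η P ξ) {ι : Type*}
    (I : Finset ι) {φ : ι → Config α → ℝ} (hφ : ∀ i, IsLocal (φ i)) {c : ι → ℝ → ℝ} {c' : ι → ℝ}
    {t : ℝ} (ht : 0 < t) (hc : ∀ i, HasDerivAt (c i) (c' i) t) :
    HasDerivAt (fun s => expect P ξ (fun ζ => ∑ i ∈ I, c i s * φ i ζ) s)
      (expect P ξ (fun ζ => ∑ i ∈ I, c' i * φ i ζ) t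
        + expect P ξ (exclGen a α fun ζ => ∑ i ∈ I, c i t * φ i ζ) t) t := by
  have hgen : exclGen a α (fun ζ => ∑ i ∈ I, c i t * φ i ζ)
      = fun ζ => ∑ i ∈ I, c i t * exclGen a α (φ i) ζ := funext fun ζ => exclGen_sum I _ hφ ζ
  rw [hgen, h.expect_sum I hφ, h.expect_sum I fun i => (hφ i).exclGen, ← Finset.sum_add_distrib]
  simp only [h.expect_sum I hφ]
  exact HasDerivAt.fun_sum fun i _ => (hc i).fun_mul (h.hasDerivAt_expect (hφ i) ht)

lemma IsExclusionProcess.continuous_expect_sum (h : IsExclusionProcess a α η P ξ) {ι : Type*}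
    (I : Finset ι) {φ : ι → Config α → ℝ} (hφ : ∀ i, IsLocal (φ i)) {c : ι → ℝ → ℝ}
    (hc : ∀ i, Continuous (c i)) :
    Continuous fun s => expect P ξ (fun ζ => ∑ i ∈ I, c i s * φ i ζ) s := by
  simp only [h.expect_sum I hφ]
  exact continuous_finsetSum _ fun i _ => (hc i).mul (h.continuous_expect (hφ i))

end Dynamics

section TruncatedSemigroup

/-- The semigroup of `BTM(a)` killed at its `k`-th jump, applied to `f` restricted to the finite
set `S`. -/
def truncSemigroup (a : ℝ) (α : Env d) (S : Finset (Site d)) (f : Site d → ℝ) (k : ℕ) (t : ℝ)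
    (x : Site d) : ℝ :=
  ∑ y ∈ S, btmProb a α k t x y * f y

variable {S : Finset (Site d)} {f : Site d → ℝ}

lemma truncSemigroup_nonneg (hf : ∀ x, 0 ≤ f x) (k : ℕ) {t : ℝ} (ht : 0 ≤ t) (x : Site d) :
    0 ≤ truncSemigroup a α S f k t x :=
  Finset.sum_nonneg fun y _ => mul_nonneg (btmProb_nonneg k x y ht) (hf y)

lemma truncSemigroup_le_succ (hf : ∀ x, 0 ≤ f x) (k : ℕ) {t : ℝ} (ht : 0 ≤ t) (x : Site d) :
    truncSemigroup a α S f k t x ≤ truncSemigroup a α S f (k + 1) t x :=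
  Finset.sum_le_sum fun y _ => mul_le_mul_of_nonneg_right (btmProb_le_succ k x y ht) (hf y)

lemma continuous_truncSemigroup (k : ℕ) (x : Site d) :
    Continuous fun t => truncSemigroup a α S f k t x :=
  continuous_finsetSum _ fun y _ => (continuous_btmProb k x y).mul continuous_const

lemma hasDerivAt_truncSemigroup (k : ℕ) (x : Site d) (t : ℝ) :
    HasDerivAt (fun t => truncSemigroup a α S f (k + 1) t x)
      (∑ z ∈ nbrs x, btmRate a α x z *
        (truncSemigroup a α S f k t z - truncSemigroup a α S f (k + 1) t x)) t := by
  refine (HasDerivAt.fun_sum fun y _ => (hasDerivAt_btmProb k x y t).mul_const (f y)).congr_deriv ?_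
  simp only [backwardFlux, btmExitRate, truncSemigroup, mul_sub, add_mul, neg_mul,
    Finset.sum_sub_distrib, Finset.sum_add_distrib, Finset.sum_neg_distrib, Finset.sum_mul,
    Finset.mul_sum, mul_assoc]
  rw [Finset.sum_comm, Finset.sum_comm (s := S)]
  ring

lemma truncSemigroup_zero (hfS : ∀ x ∉ S, f x = 0) (k : ℕ) (x : Site d) :
    truncSemigroup a α S f (k + 1) 0 x = f x := by
  simp only [truncSemigroup, btmProb_succ_zero, ite_mul, one_mul, zero_mul, Finset.sum_ite_eq]
  exact ite_eq_left_iff.2 fun hx => (hfS x hx).symm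

lemma truncSemigroup_eq_zero (k : ℕ) {t : ℝ} (ht : 0 ≤ t) {x : Site d}
    (hx : x ∉ closedNbhd^[k] S) : truncSemigroup a α S f k t x = 0 := by
  refine Finset.sum_eq_zero fun y hy => ?_
  have hzero : btmProb a α k t y x = 0 := btmProb_eq_zero k t fun h =>
    hx (closedNbhd_mono.iterate k (Finset.singleton_subset_iff.2 hy) h)
  have hrev := env_mul_btmProb_comm (a := a) (α := α) k x y ht
  rw [hzero, mul_zero, mul_eq_zero] at hrev
  rw [hrev.resolve_left (env_pos α x).ne', zero_mul]

lemma sum_truncSemigroup_mul_env (Λ : Finset (Site d)) (k : ℕ) {t : ℝ} (ht : 0 ≤ t) :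
    ∑ x ∈ Λ, truncSemigroup a α S f k t x * α x
      = ∑ y ∈ S, f y * α y * ∑ x ∈ Λ, btmProb a α k t y x := by
  simp only [truncSemigroup, Finset.sum_mul, Finset.mul_sum]
  rw [Finset.sum_comm]
  refine Finset.sum_congr rfl fun y _ => Finset.sum_congr rfl fun x _ => ?_
  linear_combination f y * env_mul_btmProb_comm (a := a) (α := α) k x y ht

lemma sum_truncSemigroup_mul_env_le (hf : ∀ x, 0 ≤ f x) (Λ : Finset (Site d)) (k : ℕ) {t : ℝ}
    (ht : 0 ≤ t) : ∑ x ∈ Λ, truncSemigroup a α S f k t x * α x ≤ ∑ y ∈ S, f y * α y := by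
  rw [sum_truncSemigroup_mul_env Λ k ht]
  exact Finset.sum_le_sum fun y _ => mul_le_of_le_one_right
    (mul_nonneg (hf y) (env_pos α y).le) (sum_btmProb_le_one k y Λ ht)

/-- An upper bound, in terms of the law of the time of the `k`-th jump, for the part of the mass
`∑ x, f x * α x` that `truncSemigroup a α S f k t` has lost. -/
def massLossBound (a : ℝ) (α : Env d) (S : Finset (Site d)) (f : Site d → ℝ) (k : ℕ) (t : ℝ) : ℝ :=
  ∑ y ∈ S, f y * α y * (Real.exp t * jumpLaplace a α k y)

lemma sub_sum_truncSemigroup_le (hf : ∀ x, 0 ≤ f x) (k : ℕ) {Λ : Finset (Site d)} {t : ℝ}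
    (ht : 0 ≤ t) (hΛ : closedNbhd^[k] S ⊆ Λ) :
    ∑ y ∈ S, f y * α y - ∑ x ∈ Λ, truncSemigroup a α S f k t x * α x
      ≤ massLossBound a α S f k t := by
  rw [sum_truncSemigroup_mul_env Λ k ht, ← Finset.sum_sub_distrib]
  refine Finset.sum_le_sum fun y hy => ?_
  rw [← mul_one_sub]
  exact mul_le_mul_of_nonneg_left (one_sub_sum_btmProb_le k y Λ
    ((closedNbhd_mono.iterate k (Finset.singleton_subset_iff.2 hy)).trans hΛ) ht)
    (mul_nonneg (hf y) (env_pos α y).le)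

lemma NonExplosive.tendsto_massLossBound (hα : NonExplosive a α) (S : Finset (Site d))
    (f : Site d → ℝ) (t : ℝ) :
    Tendsto (fun k => massLossBound a α S f k t) atTop (𝓝 0) := by
  simpa only [massLossBound, mul_zero, Finset.sum_const_zero] using tendsto_finsetSum S fun y _ =>
    ((hα y).const_mul (Real.exp t)).const_mul (f y * (α y : ℝ))

end TruncatedSemigroup

section Pairing

variable {η : Config α}

lemma pairing_of_subset {Λ T : Finset (Site d)} (h : Λ ⊆ T) {g : Site d → ℝ}
    (hg : ∀ x ∉ Λ, g x = 0) (η : Config α) : pairing Λ g η = pairing T g η :=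
  Finset.sum_subset h fun x _ hx => by rw [hg x hx, zero_mul]

lemma hasSum_pairing {S : Finset (Site d)} {f : Site d → ℝ} (hfS : ∀ x ∉ S, f x = 0)
    (η : Config α) : HasSum (fun x => f x * ((η x : ℕ) : ℝ)) (pairing S f η) :=
  hasSum_sum_of_ne_finset_zero fun x hx => by rw [hfS x hx, zero_mul]

lemma pairing_add (Λ : Finset (Site d)) (g h : Site d → ℝ) (η : Config α) :
    pairing Λ g η + pairing Λ h η = pairing Λ (fun x => g x + h x) η := by
  simp only [pairing, add_mul, Finset.sum_add_distrib]

lemma pairing_mul_pairing (Λ : Finset (Site d)) (g h : Site d → ℝ) (η : Config α) :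
    pairing Λ g η * pairing Λ h η
      = ∑ p ∈ Λ ×ˢ Λ, (g p.1 * h p.2) * (((η p.1 : ℕ) : ℝ) * ((η p.2 : ℕ) : ℝ)) := by
  rw [pairing, pairing, Finset.sum_mul_sum, Finset.sum_product]
  exact Finset.sum_congr rfl fun x _ => Finset.sum_congr rfl fun y _ => by ring

variable {Ω : Type*} {mΩ : MeasurableSpace Ω} {P : Measure Ω} {ξ : ℝ≥0 → Ω → Config α}

lemma expect_const_mul (c : ℝ) (φ : Config α → ℝ) (s : ℝ) :
    expect P ξ (fun ζ => c * φ ζ) s = c * expect P ξ φ s :=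
  integral_const_mul _ _

variable [IsProbabilityMeasure P]

lemma IsExclusionProcess.expect_mono (h : IsExclusionProcess a α η P ξ) {φ ψ : Config α → ℝ}
    (hφ : IsLocal φ) (hψ : IsLocal ψ) (hle : ∀ ζ, φ ζ ≤ ψ ζ) (s : ℝ) :
    expect P ξ φ s ≤ expect P ξ ψ s :=
  integral_mono (h.integrable hφ _) (h.integrable hψ _) fun _ => hle _

lemma IsExclusionProcess.expect_add (h : IsExclusionProcess a α η P ξ) {φ ψ : Config α → ℝ}
    (hφ : IsLocal φ) (hψ : IsLocal ψ) (s : ℝ) :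
    expect P ξ φ s + expect P ξ ψ s = expect P ξ (fun ζ => φ ζ + ψ ζ) s :=
  (integral_add (h.integrable hφ _) (h.integrable hψ _)).symm

end Pairing

section BackwardSubsolution

lemma le_of_forall_hasDerivAt_nonpos {f : ℝ → ℝ} {u v : ℝ} (huv : u ≤ v)
    (hf : ContinuousOn f (Set.Icc u v)) (hderiv : ∀ s ∈ Set.Ioo u v, ∃ D ≤ 0, HasDerivAt f D s) :
    f v ≤ f u := by
  refine antitoneOn_of_deriv_nonpos (convex_Icc u v) hf (fun s hs => ?_) (fun s hs => ?_)
    (Set.left_mem_Icc.2 huv) (Set.right_mem_Icc.2 huv) huv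
  all_goals
    rw [interior_Icc] at hs
    obtain ⟨D, hD, hfD⟩ := hderiv s hs
  · exact hfD.differentiableAt.differentiableWithinAt
  · exact hfD.deriv.trans_le hD

lemma btmGen_sq (g : Site d → ℝ) (x : Site d) :
    btmGen a α (fun y => g y ^ 2) x = btmCarre a α g x + 2 * g x * btmGen a α g x := by
  rw [btmGen, btmCarre, btmGen, Finset.mul_sum, ← Finset.sum_add_distrib]
  exact Finset.sum_congr rfl fun z _ => by ring

lemma sum_btmGen_mul_env {Λ : Finset (Site d)} {g : Site d → ℝ} (hg : ∀ x ∉ Λ, g x = 0) :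
    ∑ x ∈ closedNbhd Λ, btmGen a α g x * α x = 0 := by
  refine Eq.trans ?_ (sum_nbrs_eq_zero_of_antisymm (Λ := Λ)
    (A := fun x z => (α x : ℝ) * btmRate a α x z * (g z - g x))
    (fun x z => by rw [env_mul_btmRate_comm]; ring)
    fun x z hx hz => by rw [hg x hx, hg z hz, sub_self, mul_zero])
  refine Finset.sum_congr rfl fun x _ => ?_
  rw [btmGen, Finset.sum_mul]
  exact Finset.sum_congr rfl fun z _ => by ring

/-- The backward operator `(∂ₛ + A) g`, where `A` is the generator of `BTM(a)` and `g'` stands for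
the time derivative of `g`. -/
def backwardOp (a : ℝ) (α : Env d) (g g' : Site d → ℝ) (x : Site d) : ℝ :=
  g' x + btmGen a α g x

/-- `G`, with time derivative `G'`, is on the time interval `[0, t]` a non-negative subsolution of
the backward equation `(∂ₛ + A) G = 0`, carried by the finite set `Λ`. -/
structure BackwardSubsolution (a : ℝ) (α : Env d) (Λ : Finset (Site d)) (t : ℝ)
    (G G' : ℝ → Site d → ℝ) : Prop where
  continuous : ∀ x, Continuous fun s => G s x
  nonneg : ∀ s ∈ Set.Icc 0 t, ∀ x, 0 ≤ G s x
  eq_zero : ∀ s ∈ Set.Icc 0 t, ∀ x ∉ Λ, G s x = 0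
  hasDerivAt : ∀ s ∈ Set.Ioo 0 t, ∀ x, HasDerivAt (fun s => G s x) (G' s x) s
  backwardOp_nonneg : ∀ s ∈ Set.Ioo 0 t, ∀ x, 0 ≤ backwardOp a α (G s) (G' s) x

namespace BackwardSubsolution

variable {Λ : Finset (Site d)} {t : ℝ} {G G' : ℝ → Site d → ℝ}

lemma deriv_eq_zero (hG : BackwardSubsolution a α Λ t G G') {s : ℝ} (hs : s ∈ Set.Ioo 0 t)
    {x : Site d} (hx : x ∉ Λ) : G' s x = 0 := by
  refine (hG.hasDerivAt s hs x).unique ((hasDerivAt_const s (0 : ℝ)).congr_of_eventuallyEq ?_)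
  filter_upwards [Ioo_mem_nhds hs.1 hs.2] with u hu
    using hG.eq_zero u (Set.Ioo_subset_Icc_self hu) x hx

lemma continuous_mass (hG : BackwardSubsolution a α Λ t G G') :
    Continuous fun s => ∑ x ∈ Λ, G s x * α x :=
  continuous_finsetSum _ fun x _ => (hG.continuous x).mul continuous_const

lemma hasDerivAt_mass (hG : BackwardSubsolution a α Λ t G G') {s : ℝ} (hs : s ∈ Set.Ioo 0 t) :
    HasDerivAt (fun s => ∑ x ∈ Λ, G s x * α x)
      (∑ x ∈ closedNbhd Λ, backwardOp a α (G s) (G' s) x * α x) s := by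
  refine (HasDerivAt.fun_sum fun x _ =>
    (hG.hasDerivAt s hs x).mul_const (α x : ℝ)).congr_deriv ?_
  rw [Finset.sum_subset (subset_closedNbhd Λ) fun x _ hx => by
    rw [hG.deriv_eq_zero hs hx, zero_mul]]
  simp only [backwardOp, add_mul, Finset.sum_add_distrib,
    sum_btmGen_mul_env (hG.eq_zero s (Set.Ioo_subset_Icc_self hs)), add_zero]

lemma pairing_add_exclGen (hG : BackwardSubsolution a α Λ t G G') {s : ℝ} (hs : s ∈ Set.Ioo 0 t)
    (ζ : Config α) :
    pairing Λ (G' s) ζ + exclGen a α (pairing Λ (G s)) ζ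
      = pairing (closedNbhd Λ) (backwardOp a α (G s) (G' s)) ζ := by
  rw [pairing_of_subset (subset_closedNbhd Λ) fun x hx => hG.deriv_eq_zero hs hx,
    exclGen_pairing (hG.eq_zero s (Set.Ioo_subset_Icc_self hs)), pairing_add]
  rfl

lemma pairing_btmCarre_le (hG : BackwardSubsolution a α Λ t G G') {s : ℝ} (hs : s ∈ Set.Ioo 0 t)
    (ζ : Config α) :
    pairing (closedNbhd Λ) (btmCarre a α (G s)) ζ
      ≤ pairing Λ (fun x => 2 * G s x * G' s x) ζ
        + exclGen a α (pairing Λ fun x => G s x ^ 2) ζ := by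
  have hs' := Set.Ioo_subset_Icc_self hs
  have hsupp := hG.eq_zero s hs'
  rw [pairing_of_subset (subset_closedNbhd Λ) fun x hx => by rw [hsupp x hx, mul_zero, zero_mul],
    exclGen_pairing fun x hx => by rw [hsupp x hx, zero_pow two_ne_zero], pairing_add]
  refine pairing_mono (fun x _ => ?_) ζ
  have hsource : 0 ≤ 2 * G s x * (G' s x + btmGen a α (G s) x) :=
    mul_nonneg (mul_nonneg zero_le_two (hG.nonneg s hs' x)) (hG.backwardOp_nonneg s hs x)
  rw [btmGen_sq]
  linarith

/-- The drift of `pairing Λ (G s) ξₛ ^ 2` exceeds that of `pairing Λ (G s ^ 2) ξₛ` only through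
the defect `(∂ₛ + A) G` of the subsolution. -/
lemma drift_sq_le (hG : BackwardSubsolution a α Λ t G G') {s C : ℝ} (hs : s ∈ Set.Ioo 0 t)
    (hC : ∑ x ∈ Λ, G s x * α x ≤ C) (ζ : Config α) :
    2 * pairing Λ (G s) ζ * pairing Λ (G' s) ζ + exclGen a α (fun ζ => pairing Λ (G s) ζ ^ 2) ζ
      ≤ (pairing Λ (fun x => 2 * G s x * G' s x) ζ + exclGen a α (pairing Λ fun x => G s x ^ 2) ζ)
        + 2 * C * pairing (closedNbhd Λ) (backwardOp a α (G s) (G' s)) ζ := by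
  have hs' := Set.Ioo_subset_Icc_self hs
  have hsq := exclGen_pairing_sq_le (a := a) (hG.eq_zero s hs') ζ
  have hcarre := hG.pairing_btmCarre_le hs ζ
  have hdefect : pairing Λ (G s) ζ * pairing (closedNbhd Λ) (backwardOp a α (G s) (G' s)) ζ
      ≤ C * pairing (closedNbhd Λ) (backwardOp a α (G s) (G' s)) ζ :=
    mul_le_mul_of_nonneg_right ((pairing_le (hG.nonneg s hs') ζ).trans hC)
      (pairing_nonneg (hG.backwardOp_nonneg s hs) ζ)
  rw [← hG.pairing_add_exclGen hs] at hdefect ⊢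
  linarith

variable {η : Config α} {Ω : Type*} {mΩ : MeasurableSpace Ω} {P : Measure Ω}
  {ξ : ℝ≥0 → Ω → Config α} [IsProbabilityMeasure P]

lemma continuous_expect (hG : BackwardSubsolution a α Λ t G G')
    (h : IsExclusionProcess a α η P ξ) :
    Continuous fun s => expect P ξ (pairing Λ (G s)) s :=
  h.continuous_expect_sum Λ isLocal_coord hG.continuous

lemma hasDerivAt_expect (hG : BackwardSubsolution a α Λ t G G')
    (h : IsExclusionProcess a α η P ξ) {s : ℝ} (hs : s ∈ Set.Ioo 0 t) :
    HasDerivAt (fun s => expect P ξ (pairing Λ (G s)) s)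
      (expect P ξ (pairing (closedNbhd Λ) (backwardOp a α (G s) (G' s))) s) s := by
  refine (h.hasDerivAt_expect_sum Λ isLocal_coord hs.1 (hG.hasDerivAt s hs)).congr_deriv ?_
  refine (h.expect_add (isLocal_pairing Λ _) (isLocal_pairing Λ _).exclGen s).trans ?_
  exact congrArg (expect P ξ · s) (funext fun ζ => hG.pairing_add_exclGen hs ζ)

lemma expect_backwardOp_le (hG : BackwardSubsolution a α Λ t G G')
    (h : IsExclusionProcess a α η P ξ) {s : ℝ} (hs : s ∈ Set.Ioo 0 t) :
    expect P ξ (pairing (closedNbhd Λ) (backwardOp a α (G s) (G' s))) s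
      ≤ ∑ x ∈ closedNbhd Λ, backwardOp a α (G s) (G' s) x * α x := by
  refine (h.expect_mono (isLocal_pairing _ _) (isLocal_const _)
    (fun ζ => pairing_le (hG.backwardOp_nonneg s hs) ζ) s).trans_eq ?_
  rw [expect, integral_const, probReal_univ, one_smul]

lemma expect_pairing_le (hG : BackwardSubsolution a α Λ t G G')
    (h : IsExclusionProcess a α η P ξ) (ht : 0 ≤ t) :
    expect P ξ (pairing Λ (G t)) t - ∑ x ∈ Λ, G t x * α x
      ≤ pairing Λ (G 0) η - ∑ x ∈ Λ, G 0 x * α x := by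
  have hle := le_of_forall_hasDerivAt_nonpos ht
    ((hG.continuous_expect h).sub hG.continuous_mass).continuousOn fun s hs =>
      ⟨_, sub_nonpos.2 (hG.expect_backwardOp_le h hs),
        (hG.hasDerivAt_expect h hs).sub (hG.hasDerivAt_mass hs)⟩
  simpa only [h.expect_zero, Pi.sub_apply] using hle

lemma continuous_expect_sq (hG : BackwardSubsolution a α Λ t G G')
    (h : IsExclusionProcess a α η P ξ) :
    Continuous fun s => expect P ξ (fun ζ => pairing Λ (G s) ζ ^ 2) s := by
  simp only [pow_two, pairing_mul_pairing]
  exact h.continuous_expect_sum (Λ ×ˢ Λ) (fun p => (isLocal_coord p.1).mul (isLocal_coord p.2))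
    fun p => (hG.continuous p.1).mul (hG.continuous p.2)

lemma hasDerivAt_expect_sq (hG : BackwardSubsolution a α Λ t G G')
    (h : IsExclusionProcess a α η P ξ) {s : ℝ} (hs : s ∈ Set.Ioo 0 t) :
    HasDerivAt (fun s => expect P ξ (fun ζ => pairing Λ (G s) ζ ^ 2) s)
      (expect P ξ (fun ζ => 2 * pairing Λ (G s) ζ * pairing Λ (G' s) ζ
        + exclGen a α (fun ζ => pairing Λ (G s) ζ ^ 2) ζ) s) s := by
  have hderiv := h.hasDerivAt_expect_sum (Λ ×ˢ Λ)
    (fun p => (isLocal_coord p.1).mul (isLocal_coord p.2)) hs.1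
    (fun p => (hG.hasDerivAt s hs p.1).fun_mul (hG.hasDerivAt s hs p.2))
  simp only [add_mul, Finset.sum_add_distrib, ← pairing_mul_pairing, ← pow_two] at hderiv
  refine hderiv.congr_deriv ((h.expect_add ?_ (isLocal_pairing_sq Λ (G s)).exclGen s).trans
    (congrArg (expect P ξ · s) (funext fun ζ => ?_)))
  · exact ((isLocal_pairing Λ _).mul (isLocal_pairing Λ _)).add
      ((isLocal_pairing Λ _).mul (isLocal_pairing Λ _))
  · ring

lemma continuous_expect_pairing_sq (hG : BackwardSubsolution a α Λ t G G')
    (h : IsExclusionProcess a α η P ξ) :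
    Continuous fun s => expect P ξ (pairing Λ fun x => G s x ^ 2) s :=
  h.continuous_expect_sum Λ isLocal_coord fun x => (hG.continuous x).pow 2

lemma hasDerivAt_expect_pairing_sq (hG : BackwardSubsolution a α Λ t G G')
    (h : IsExclusionProcess a α η P ξ) {s : ℝ} (hs : s ∈ Set.Ioo 0 t) :
    HasDerivAt (fun s => expect P ξ (pairing Λ fun x => G s x ^ 2) s)
      (expect P ξ (fun ζ => pairing Λ (fun x => 2 * G s x * G' s x) ζ
        + exclGen a α (pairing Λ fun x => G s x ^ 2) ζ) s) s := by
  refine (h.hasDerivAt_expect_sum Λ isLocal_coord hs.1 fun x =>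
    (hG.hasDerivAt s hs x).fun_pow 2).congr_deriv ?_
  refine (h.expect_add (isLocal_pairing Λ _) (isLocal_pairing Λ _).exclGen s).trans ?_
  simp only [Nat.cast_ofNat, Nat.add_one_sub_one, pow_one]

lemma expect_drift_sq_le (hG : BackwardSubsolution a α Λ t G G')
    (h : IsExclusionProcess a α η P ξ) {s C : ℝ} (hs : s ∈ Set.Ioo 0 t)
    (hC : ∑ x ∈ Λ, G s x * α x ≤ C) :
    expect P ξ (fun ζ => 2 * pairing Λ (G s) ζ * pairing Λ (G' s) ζ
        + exclGen a α (fun ζ => pairing Λ (G s) ζ ^ 2) ζ) s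
      ≤ expect P ξ (fun ζ => pairing Λ (fun x => 2 * G s x * G' s x) ζ
          + exclGen a α (pairing Λ fun x => G s x ^ 2) ζ) s
        + 2 * C * ∑ x ∈ closedNbhd Λ, backwardOp a α (G s) (G' s) x * α x := by
  have hC0 : 0 ≤ C := (Finset.sum_nonneg fun x _ =>
    mul_nonneg (hG.nonneg s (Set.Ioo_subset_Icc_self hs) x) (env_pos α x).le).trans hC
  have hlocal_sq : IsLocal fun ζ : Config α => 2 * pairing Λ (G s) ζ * pairing Λ (G' s) ζ
      + exclGen a α (fun ζ => pairing Λ (G s) ζ ^ 2) ζ :=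
    (((isLocal_const 2).mul (isLocal_pairing Λ _)).mul (isLocal_pairing Λ _)).add
      (isLocal_pairing_sq Λ (G s)).exclGen
  have hlocal_pairing : IsLocal fun ζ : Config α => pairing Λ (fun x => 2 * G s x * G' s x) ζ
      + exclGen a α (pairing Λ fun x => G s x ^ 2) ζ :=
    (isLocal_pairing Λ _).add (isLocal_pairing Λ _).exclGen
  have hlocal_defect : IsLocal fun ζ : Config α =>
      2 * C * pairing (closedNbhd Λ) (backwardOp a α (G s) (G' s)) ζ :=
    (isLocal_const _).mul (isLocal_pairing _ _)
  refine (h.expect_mono hlocal_sq (hlocal_pairing.add hlocal_defect)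
    (hG.drift_sq_le hs hC) s).trans ?_
  rw [← h.expect_add hlocal_pairing hlocal_defect, expect_const_mul]
  gcongr
  exact hG.expect_backwardOp_le h hs

lemma expect_sq_le (hG : BackwardSubsolution a α Λ t G G')
    (h : IsExclusionProcess a α η P ξ) (ht : 0 ≤ t) {C : ℝ}
    (hC : ∀ s ∈ Set.Ioo 0 t, ∑ x ∈ Λ, G s x * α x ≤ C) :
    expect P ξ (fun ζ => pairing Λ (G t) ζ ^ 2) t
        - 2 * pairing Λ (G 0) η * expect P ξ (pairing Λ (G t)) t + pairing Λ (G 0) η ^ 2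
      ≤ expect P ξ (pairing Λ fun x => G t x ^ 2) t - pairing Λ (fun x => G 0 x ^ 2) η
        + 2 * C * (∑ x ∈ Λ, G t x * α x - ∑ x ∈ Λ, G 0 x * α x) := by
  have hmean : 0 ≤ 2 * pairing Λ (G 0) η :=
    mul_nonneg zero_le_two (pairing_nonneg (hG.nonneg 0 (Set.left_mem_Icc.2 ht)) η)
  have hdrift : ∀ s ∈ Set.Ioo 0 t, expect P ξ (fun ζ => 2 * pairing Λ (G s) ζ * pairing Λ (G' s) ζ
        + exclGen a α (fun ζ => pairing Λ (G s) ζ ^ 2) ζ) s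
      - 2 * pairing Λ (G 0) η
        * expect P ξ (pairing (closedNbhd Λ) (backwardOp a α (G s) (G' s))) s
      - expect P ξ (fun ζ => pairing Λ (fun x => 2 * G s x * G' s x) ζ
        + exclGen a α (pairing Λ fun x => G s x ^ 2) ζ) s
      - 2 * C * ∑ x ∈ closedNbhd Λ, backwardOp a α (G s) (G' s) x * α x ≤ 0 := fun s hs => by
    have hdefect : 0 ≤ expect P ξ (pairing (closedNbhd Λ) (backwardOp a α (G s) (G' s))) s :=
      integral_nonneg fun ω => pairing_nonneg (hG.backwardOp_nonneg s hs) _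
    linarith [hG.expect_drift_sq_le h hs (hC s hs), mul_nonneg hmean hdefect]
  have hle := le_of_forall_hasDerivAt_nonpos ht
    ((((hG.continuous_expect_sq h).sub
      ((hG.continuous_expect h).const_mul (2 * pairing Λ (G 0) η))).sub
      (hG.continuous_expect_pairing_sq h)).sub
      (hG.continuous_mass.const_mul (2 * C))).continuousOn fun s hs => ⟨_, hdrift s hs,
        (((hG.hasDerivAt_expect_sq h hs).sub
          ((hG.hasDerivAt_expect h hs).const_mul (2 * pairing Λ (G 0) η))).sub
          (hG.hasDerivAt_expect_pairing_sq h hs)).sub ((hG.hasDerivAt_mass hs).const_mul (2 * C))⟩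
  simp only [h.expect_zero, Pi.sub_apply] at hle
  linarith

end BackwardSubsolution

end BackwardSubsolution

section Semigroup

variable {S : Finset (Site d)} {f : Site d → ℝ}

lemma btmProb_le_one (k : ℕ) (x y : Site d) {t : ℝ} (ht : 0 ≤ t) : btmProb a α k t x y ≤ 1 := by
  simpa only [Finset.sum_singleton] using sum_btmProb_le_one (a := a) (α := α) k x {y} ht

lemma tendsto_btmProb (x y : Site d) {t : ℝ} (ht : 0 ≤ t) :
    Tendsto (fun k => btmProb a α k t x y) atTop (𝓝 (btmTransition a α t x y).toReal) := by
  have htransition : btmTransition a α t x y = ⨆ k, ENNReal.ofReal (btmProb a α k t x y) := by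
    simp only [btmTransition, btmIter_eq_ofReal _ x y ht]
  have hfinite : btmTransition a α t x y ≠ ∞ := by
    refine ne_top_of_le_ne_top ENNReal.one_ne_top ?_
    rw [htransition]
    exact iSup_le fun k => ENNReal.ofReal_le_one.2 (btmProb_le_one k x y ht)
  have hlim := tendsto_atTop_iSup (ENNReal.ofReal_mono.comp
    (btmProb_monotone (a := a) (α := α) x y ht))
  refine ((ENNReal.tendsto_toReal hfinite).comp (htransition ▸ hlim)).congr fun k => ?_
  exact ENNReal.toReal_ofReal (btmProb_nonneg k x y ht)

lemma env_mul_btmTransition_comm (x y : Site d) {t : ℝ} (ht : 0 ≤ t) :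
    (α x : ℝ) * (btmTransition a α t x y).toReal
      = α y * (btmTransition a α t y x).toReal :=
  tendsto_nhds_unique ((tendsto_btmProb x y ht).const_mul _)
    (((tendsto_btmProb y x ht).const_mul _).congr fun k => (env_mul_btmProb_comm k x y ht).symm)

lemma summable_btmTransition (x : Site d) {t : ℝ} (ht : 0 ≤ t) :
    Summable fun y => (btmTransition a α t x y).toReal :=
  summable_of_sum_le (fun _ => ENNReal.toReal_nonneg) fun Λ =>
    le_of_tendsto' (tendsto_finsetSum Λ fun y _ => tendsto_btmProb x y ht)
      fun k => sum_btmProb_le_one k x Λ ht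

/-- The semigroup of `BTM(a)` applied to `f` restricted to the finite set `S`. -/
def btmSemigroup (a : ℝ) (α : Env d) (S : Finset (Site d)) (f : Site d → ℝ) (t : ℝ) (x : Site d) :
    ℝ :=
  ∑ y ∈ S, (btmTransition a α t x y).toReal * f y

lemma tendsto_truncSemigroup (x : Site d) {t : ℝ} (ht : 0 ≤ t) :
    Tendsto (fun k => truncSemigroup a α S f k t x) atTop (𝓝 (btmSemigroup a α S f t x)) :=
  tendsto_finsetSum _ fun y _ => (tendsto_btmProb x y ht).mul_const _

lemma truncSemigroup_le (hf : ∀ x, 0 ≤ f x) (k : ℕ) {t : ℝ} (ht : 0 ≤ t) (x : Site d) :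
    truncSemigroup a α S f k t x ≤ btmSemigroup a α S f t x :=
  (monotone_nat_of_le_succ fun k => truncSemigroup_le_succ hf k ht x).ge_of_tendsto
    (tendsto_truncSemigroup x ht) k

lemma btmSemigroup_nonneg (hf : ∀ x, 0 ≤ f x) (t : ℝ) (x : Site d) :
    0 ≤ btmSemigroup a α S f t x :=
  Finset.sum_nonneg fun y _ => mul_nonneg ENNReal.toReal_nonneg (hf y)

lemma btmSemigroup_le_sum (hf : ∀ x, 0 ≤ f x) {t : ℝ} (ht : 0 ≤ t) (x : Site d) :
    btmSemigroup a α S f t x ≤ ∑ y ∈ S, f y :=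
  Finset.sum_le_sum fun y _ => mul_le_of_le_one_left (hf y)
    (le_of_tendsto' (tendsto_btmProb x y ht) fun k => btmProb_le_one k x y ht)

lemma summable_btmSemigroup_mul_env {t : ℝ} (ht : 0 ≤ t) :
    Summable fun x => btmSemigroup a α S f t x * α x := by
  simp only [btmSemigroup, Finset.sum_mul]
  refine summable_sum fun y _ =>
    ((summable_btmTransition (a := a) (α := α) y ht).mul_left (α y * f y)).congr fun x => ?_
  linear_combination f y * env_mul_btmTransition_comm (a := a) (α := α) y x ht

lemma summable_btmSemigroup_mul (η : Config α) (hf : ∀ x, 0 ≤ f x) {t : ℝ} (ht : 0 ≤ t) :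
    Summable fun x => btmSemigroup a α S f t x * ((η x : ℕ) : ℝ) :=
  (summable_btmSemigroup_mul_env ht).of_nonneg_of_le
    (fun x => mul_nonneg (btmSemigroup_nonneg hf t x) (Nat.cast_nonneg _))
    fun x => mul_le_mul_of_nonneg_left (config_le η x) (btmSemigroup_nonneg hf t x)

lemma summable_btmSemigroup_sq_mul (η : Config α) (hf : ∀ x, 0 ≤ f x) {t : ℝ} (ht : 0 ≤ t) :
    Summable fun x => btmSemigroup a α S f t x ^ 2 * ((η x : ℕ) : ℝ) := by
  refine ((summable_btmSemigroup_mul (a := a) (S := S) η hf ht).mul_left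
    (∑ y ∈ S, f y)).of_nonneg_of_le
    (fun x => mul_nonneg (sq_nonneg _) (Nat.cast_nonneg _)) fun x => ?_
  rw [pow_two, mul_assoc]
  exact mul_le_mul_of_nonneg_right (btmSemigroup_le_sum hf ht x)
    (mul_nonneg (btmSemigroup_nonneg hf t x) (Nat.cast_nonneg _))

variable {η : Config α}

lemma tendsto_pairing {Λ : ℕ → Finset (Site d)} {g : ℕ → Site d → ℝ} {g' b : Site d → ℝ}
    (hg : ∀ k, ∀ x ∉ Λ k, g k x = 0) (hlim : ∀ x, Tendsto (fun k => g k x) atTop (𝓝 (g' x)))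
    (hb : ∀ k x, |g k x| ≤ b x) (hsum : Summable fun x => b x * ((η x : ℕ) : ℝ)) :
    Tendsto (fun k => pairing (Λ k) (g k) η) atTop (𝓝 (∑' x, g' x * ((η x : ℕ) : ℝ))) := by
  have htsum : ∀ k, pairing (Λ k) (g k) η = ∑' x, g k x * ((η x : ℕ) : ℝ) := fun k =>
    (hasSum_pairing (hg k) η).tsum_eq.symm
  simp only [htsum]
  refine tendsto_tsum_of_dominated_convergence hsum (fun x => (hlim x).mul_const _)
    (Eventually.of_forall fun k x => ?_)
  rw [norm_mul, Real.norm_natCast]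
  exact mul_le_mul_of_nonneg_right (hb k x) (Nat.cast_nonneg _)

lemma tendsto_pairing_truncSemigroup (η : Config α) (hf : ∀ x, 0 ≤ f x) {t : ℝ} (ht : 0 ≤ t) :
    Tendsto (fun k => pairing (closedNbhd^[k] S) (truncSemigroup a α S f k t) η) atTop
      (𝓝 (∑' x, btmSemigroup a α S f t x * ((η x : ℕ) : ℝ))) :=
  tendsto_pairing (fun k _ hx => truncSemigroup_eq_zero k ht hx)
    (fun x => tendsto_truncSemigroup x ht)
    (fun k x => by
      rw [abs_of_nonneg (truncSemigroup_nonneg hf k ht x)]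
      exact truncSemigroup_le hf k ht x) (summable_btmSemigroup_mul η hf ht)

lemma tendsto_pairing_truncSemigroup_sq (η : Config α) (hf : ∀ x, 0 ≤ f x) {t : ℝ} (ht : 0 ≤ t) :
    Tendsto (fun k => pairing (closedNbhd^[k] S) (fun x => truncSemigroup a α S f k t x ^ 2) η)
      atTop (𝓝 (∑' x, btmSemigroup a α S f t x ^ 2 * ((η x : ℕ) : ℝ))) :=
  tendsto_pairing (fun k _ hx => by rw [truncSemigroup_eq_zero k ht hx, zero_pow two_ne_zero])
    (fun x => (tendsto_truncSemigroup x ht).pow 2)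
    (fun k x => by
      rw [abs_of_nonneg (sq_nonneg _)]
      exact pow_le_pow_left₀ (truncSemigroup_nonneg hf k ht x) (truncSemigroup_le hf k ht x) 2)
    (summable_btmSemigroup_sq_mul η hf ht)

end Semigroup

section Variance

variable {S : Finset (Site d)} {f : Site d → ℝ}

/-- Each term `truncSemigroup (k + 1) z - truncSemigroup k z` of `backwardOp` is the contribution
of the paths with exactly `k` jumps. -/
lemma backwardSubsolution_truncSemigroup (S : Finset (Site d)) (hf : ∀ x, 0 ≤ f x) (k : ℕ)
    (t : ℝ) :
    BackwardSubsolution a α (closedNbhd^[k + 1] S) t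
      (fun s => truncSemigroup a α S f (k + 1) (t - s))
      (fun s x => -∑ z ∈ nbrs x, btmRate a α x z *
        (truncSemigroup a α S f k (t - s) z - truncSemigroup a α S f (k + 1) (t - s) x)) where
  continuous x := (continuous_truncSemigroup (k + 1) x).comp (continuous_const.sub continuous_id)
  nonneg s hs x := truncSemigroup_nonneg hf _ (sub_nonneg.2 hs.2) x
  eq_zero s hs x hx := truncSemigroup_eq_zero _ (sub_nonneg.2 hs.2) hx
  hasDerivAt s _ x := ((hasDerivAt_truncSemigroup k x (t - s)).scomp s
    ((hasDerivAt_id s).const_sub t)).congr_deriv (neg_one_smul ℝ _)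
  backwardOp_nonneg s hs x := by
    have hbackwardOp : backwardOp a α (truncSemigroup a α S f (k + 1) (t - s))
        (fun x => -∑ z ∈ nbrs x, btmRate a α x z *
          (truncSemigroup a α S f k (t - s) z - truncSemigroup a α S f (k + 1) (t - s) x)) x
        = ∑ z ∈ nbrs x, btmRate a α x z *
          (truncSemigroup a α S f (k + 1) (t - s) z - truncSemigroup a α S f k (t - s) z) := by
      rw [backwardOp, btmGen, neg_add_eq_sub, ← Finset.sum_sub_distrib]
      exact Finset.sum_congr rfl fun z _ => by ring
    rw [hbackwardOp]
    exact Finset.sum_nonneg fun z _ => mul_nonneg (btmRate_nonneg _ _)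
      (sub_nonneg.2 (truncSemigroup_le_succ hf k (sub_nonneg.2 hs.2.le) z))

variable {η : Config α} {Ω : Type*} {mΩ : MeasurableSpace Ω} {P : Measure Ω}
  {ξ : ℝ≥0 → Ω → Config α} [IsProbabilityMeasure P]

lemma IsExclusionProcess.expect_pairing_le (h : IsExclusionProcess a α η P ξ) (hf : ∀ x, 0 ≤ f x)
    (hfS : ∀ x ∉ S, f x = 0) (k : ℕ) {t : ℝ} (ht : 0 ≤ t) :
    expect P ξ (pairing S f) t
      ≤ pairing (closedNbhd^[k + 1] S) (truncSemigroup a α S f (k + 1) t) η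
        + massLossBound a α S f (k + 1) t := by
  have hsub := subset_iterate_closedNbhd (k + 1) S
  have hinit : truncSemigroup a α S f (k + 1) 0 = f := funext (truncSemigroup_zero hfS k)
  have hpairing : pairing (α := α) (closedNbhd^[k + 1] S) f = pairing S f :=
    funext fun ζ => (pairing_of_subset hsub hfS ζ).symm
  have hmass : ∑ x ∈ closedNbhd^[k + 1] S, f x * (α x : ℝ) = ∑ x ∈ S, f x * α x :=
    (Finset.sum_subset hsub fun x _ hx => by rw [hfS x hx, zero_mul]).symm
  have hle := (backwardSubsolution_truncSemigroup S hf k t).expect_pairing_le h ht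
  simp only [sub_self, sub_zero, hinit, hpairing, hmass] at hle
  linarith [sub_sum_truncSemigroup_le (a := a) (α := α) (S := S) hf (k + 1) ht subset_rfl]

lemma IsExclusionProcess.expect_sq_le (h : IsExclusionProcess a α η P ξ) (hf : ∀ x, 0 ≤ f x)
    (hfS : ∀ x ∉ S, f x = 0) (k : ℕ) {t : ℝ} (ht : 0 ≤ t) :
    expect P ξ (fun ζ => pairing S f ζ ^ 2) t
      - 2 * pairing (closedNbhd^[k + 1] S) (truncSemigroup a α S f (k + 1) t) η
        * expect P ξ (pairing S f) t
      + pairing (closedNbhd^[k + 1] S) (truncSemigroup a α S f (k + 1) t) η ^ 2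
    ≤ pairing (closedNbhd^[k + 1] S) (truncSemigroup a α S (fun x => f x ^ 2) (k + 1) t) η
      - pairing (closedNbhd^[k + 1] S) (fun x => truncSemigroup a α S f (k + 1) t x ^ 2) η
      + massLossBound a α S (fun x => f x ^ 2) (k + 1) t
      + 2 * (∑ y ∈ S, f y * α y) * massLossBound a α S f (k + 1) t := by
  have hf2S : ∀ x ∉ S, f x ^ 2 = 0 := fun x hx => by rw [hfS x hx, zero_pow two_ne_zero]
  have hsub := subset_iterate_closedNbhd (k + 1) S
  have hinit : truncSemigroup a α S f (k + 1) 0 = f := funext (truncSemigroup_zero hfS k)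
  have hpairing : pairing (α := α) (closedNbhd^[k + 1] S) f = pairing S f :=
    funext fun ζ => (pairing_of_subset hsub hfS ζ).symm
  have hpairing_sq : pairing (α := α) (closedNbhd^[k + 1] S) (fun x => f x ^ 2)
      = pairing S fun x => f x ^ 2 :=
    funext fun ζ => (pairing_of_subset hsub hf2S ζ).symm
  have hmass : ∑ x ∈ closedNbhd^[k + 1] S, f x * (α x : ℝ) = ∑ x ∈ S, f x * α x :=
    (Finset.sum_subset hsub fun x _ hx => by rw [hfS x hx, zero_mul]).symm
  have hmass_nonneg : 0 ≤ ∑ y ∈ S, f y * α y :=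
    Finset.sum_nonneg fun y _ => mul_nonneg (hf y) (env_pos α y).le
  have hloss := mul_le_mul_of_nonneg_left
    (sub_sum_truncSemigroup_le (a := a) (α := α) (S := S) hf (k + 1) ht subset_rfl)
    (mul_nonneg zero_le_two hmass_nonneg)
  have hle := (backwardSubsolution_truncSemigroup S hf k t).expect_sq_le h ht
    fun s hs => sum_truncSemigroup_mul_env_le hf _ _ (sub_nonneg.2 hs.2.le)
  simp only [sub_self, sub_zero, hinit, hpairing, hpairing_sq, hmass] at hle
  linarith [h.expect_pairing_le (fun x => sq_nonneg (f x)) hf2S k ht]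

lemma IsExclusionProcess.integrable_pairing_sub_sq (h : IsExclusionProcess a α η P ξ)
    (S : Finset (Site d)) (f : Site d → ℝ) (m : ℝ) (t : ℝ≥0) :
    Integrable (fun ω => (pairing S f (ξ t ω) - m) ^ 2) P := by
  have hlocal : IsLocal fun ζ : Config α => pairing S f ζ + -m :=
    (isLocal_pairing S f).add (isLocal_const _)
  simpa only [sub_eq_add_neg, pow_two] using h.integrable (hlocal.mul hlocal) t

lemma IsExclusionProcess.integral_pairing_sub_sq (h : IsExclusionProcess a α η P ξ)
    (S : Finset (Site d)) (f : Site d → ℝ) (m : ℝ) (t : ℝ≥0) :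
    ∫ ω, (pairing S f (ξ t ω) - m) ^ 2 ∂P
      = expect P ξ (fun ζ => pairing S f ζ ^ 2) t - 2 * m * expect P ξ (pairing S f) t
        + m ^ 2 := by
  have hsq := h.integrable (isLocal_pairing_sq S f) t
  have hcross := (h.integrable (isLocal_pairing S f) t).const_mul (2 * m)
  have hexpand : ∀ ω, (pairing S f (ξ t ω) - m) ^ 2
      = pairing S f (ξ t ω) ^ 2 - 2 * m * pairing S f (ξ t ω) + m ^ 2 := fun ω => by ring
  simp only [hexpand, expect, Real.toNNReal_coe]
  refine (integral_add (hsq.sub hcross) (integrable_const _)).trans ?_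
  rw [integral_sub' hsq hcross, integral_const_mul, integral_const, probReal_univ, one_smul]

/-- The right-hand side is the variance for independent `BTM(a)` particles with the same initial
positions. -/
theorem IsExclusionProcess.integral_pairing_sub_sq_le (h : IsExclusionProcess a α η P ξ)
    (hα : NonExplosive a α) (hf : ∀ x, 0 ≤ f x) (hfS : ∀ x ∉ S, f x = 0) (t : ℝ≥0) :
    ∫ ω, (pairing S f (ξ t ω) - ∑' x, btmSemigroup a α S f t x * ((η x : ℕ) : ℝ)) ^ 2 ∂P
      ≤ ∑' x, (btmSemigroup a α S (fun x => f x ^ 2) t x - btmSemigroup a α S f t x ^ 2)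
        * ((η x : ℕ) : ℝ) := by
  have ht : 0 ≤ (t : ℝ) := t.coe_nonneg
  have hf2 : ∀ x, 0 ≤ f x ^ 2 := fun x => sq_nonneg _
  have hmean := tendsto_pairing_truncSemigroup (a := a) (S := S) η hf ht
  have hmean_sq := tendsto_pairing_truncSemigroup_sq (a := a) (S := S) η hf ht
  have hsecond := tendsto_pairing_truncSemigroup (a := a) (S := S) η hf2 ht
  have hloss := hα.tendsto_massLossBound S f t
  have hloss_sq := hα.tendsto_massLossBound S (fun x => f x ^ 2) t
  have hleft := (((hmean.const_mul 2).mul_const (expect P ξ (pairing S f) t)).const_sub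
    (expect P ξ (fun ζ => pairing S f ζ ^ 2) t)).add (hmean.pow 2)
  have hright := ((hsecond.sub hmean_sq).add hloss_sq).add
    (hloss.const_mul (2 * ∑ y ∈ S, f y * (α y : ℝ)))
  have hle := le_of_tendsto_of_tendsto' (hleft.comp (tendsto_add_atTop_nat 1))
    (hright.comp (tendsto_add_atTop_nat 1)) fun k => h.expect_sq_le hf hfS k ht
  rw [h.integral_pairing_sub_sq]
  simpa only [mul_zero, add_zero, sub_mul, (summable_btmSemigroup_mul η hf2 ht).tsum_sub
    (summable_btmSemigroup_sq_mul η hf ht)] using hle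

end Variance

section DensityField

variable {β : ℝ} {n : ℕ}

lemma scaledSite_injective (hn : 1 ≤ n) : Function.Injective (scaledSite (d := d) n) := by
  intro x y h
  have hn' : (n : ℝ) ≠ 0 := Nat.cast_ne_zero.2 (Nat.one_le_iff_ne_zero.1 hn)
  funext i
  have hi : (x i : ℝ) / n = y i / n := congrArg (fun z : EuclideanSpace ℝ (Fin d) => z i) h
  exact_mod_cast (div_left_inj' hn').1 hi

lemma finite_norm_scaledSite_le (hn : 1 ≤ n) (R : ℝ) :
    {x : Site d | ‖scaledSite n x‖ ≤ R}.Finite := by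
  have hn' : (0 : ℝ) < n := Nat.cast_pos.2 hn
  refine (Set.finite_Icc (fun _ : Fin d => -⌈R * n⌉) (fun _ => ⌈R * n⌉)).subset fun x hx => ?_
  have hcoord : ∀ i, |x i| ≤ ⌈R * n⌉ := fun i => by
    have hi : |(x i : ℝ) / n| ≤ R := (PiLp.norm_apply_le (scaledSite n x) i).trans hx
    rw [abs_div, Nat.abs_cast, div_le_iff₀ hn'] at hi
    exact_mod_cast hi.trans (Int.le_ceil _)
  exact ⟨fun i => (abs_le.1 (hcoord i)).1, fun i => (abs_le.1 (hcoord i)).2⟩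

lemma exists_finset_scaledSite (hn : 1 ≤ n) {f : EuclideanSpace ℝ (Fin d) → ℝ}
    (hf : HasCompactSupport f) : ∃ S : Finset (Site d), ∀ x ∉ S, f (scaledSite n x) = 0 := by
  obtain ⟨R, hR⟩ := hf.isBounded.exists_norm_le
  refine ⟨(finite_norm_scaledSite_le hn R).toFinset, fun x hx => by_contra fun hne => hx ?_⟩
  exact (Set.Finite.mem_toFinset _).2 (hR _ (subset_tsupport f hne))

lemma semigroup_scaledSite (hn : 1 ≤ n) (t : ℝ≥0) {f : EuclideanSpace ℝ (Fin d) → ℝ}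
    {S : Finset (Site d)} (hfS : ∀ x ∉ S, f (scaledSite n x) = 0) (x : Site d) :
    semigroup a β α n t f (scaledSite n x)
      = btmSemigroup a α S (fun y => f (scaledSite n y)) (t * timeScale d β n : ℝ≥0) x := by
  rw [semigroup, (scaledSite_injective hn).extend_apply]
  exact tsum_eq_sum fun y hy => by rw [hfS y hy, mul_zero]

lemma integrable_densityField {g : EuclideanSpace ℝ (Fin d) → ℝ} {η : Config α}
    (hg : Summable fun x => g (scaledSite n x) * ((η x : ℕ) : ℝ)) :
    Integrable g (densityField β n η) := by
  refine (integrable_sum_dirac (fun x => ENNReal.natCast_ne_top _) ?_).smul_measure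
    ENNReal.ofReal_ne_top
  refine hg.norm.congr fun x => ?_
  rw [norm_mul, Real.norm_natCast, ENNReal.toReal_natCast, mul_comm]

lemma integral_densityField (g : EuclideanSpace ℝ (Fin d) → ℝ) (η : Config α) :
    ∫ z, g z ∂(densityField β n η)
      = 1 / (n : ℝ) ^ ((d : ℝ) / β) * ∑' x, g (scaledSite n x) * ((η x : ℕ) : ℝ) := by
  have hscale : (0 : ℝ) ≤ 1 / (n : ℝ) ^ ((d : ℝ) / β) := by positivity
  rw [densityField, integral_smul_measure, ENNReal.toReal_ofReal hscale, smul_eq_mul,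
    integral_sum_dirac fun x => ENNReal.natCast_ne_top _]
  simp only [ENNReal.toReal_natCast, smul_eq_mul, mul_comm]

end DensityField

end BouchaudExclusion

end

open BouchaudExclusion in
theorem proposition3p1_general (d : ℕ) (β a : ℝ) (ν : Measure ℕ+) [IsProbabilityMeasure ν] :
    ∀ᵐ α ∂(envLaw d ν),
      ∀ (η : Config α) (Ω : Type*) (mΩ : MeasurableSpace Ω) (P : Measure Ω)
        (_ : IsProbabilityMeasure P) (ξ : ℝ≥0 → Ω → Config α),
        IsExclusionProcess a α η P ξ →
      ∀ (t : ℝ≥0) (n : ℕ), 1 ≤ n →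
      ∀ f : EuclideanSpace ℝ (Fin d) → ℝ, HasCompactSupport f → (∀ z, 0 ≤ f z) →
        (∀ ω, Integrable f (densityField β n (ξ (t * timeScale d β n) ω))) ∧
        Integrable (semigroup a β α n t f) (densityField β n η) ∧
        Integrable (fun z => semigroup a β α n t (fun w => f w ^ 2) z
          - (semigroup a β α n t f z) ^ 2) (densityField β n η) ∧
        Integrable (fun ω => (∫ z, f z ∂(densityField β n (ξ (t * timeScale d β n) ω))
          - ∫ z, semigroup a β α n t f z ∂(densityField β n η)) ^ 2) P ∧
        ∫ ω, (∫ z, f z ∂(densityField β n (ξ (t * timeScale d β n) ω))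
          - ∫ z, semigroup a β α n t f z ∂(densityField β n η)) ^ 2 ∂P
        ≤ 1 / (n : ℝ) ^ ((d : ℝ) / β) *
          ∫ z, (semigroup a β α n t (fun w => f w ^ 2) z
            - (semigroup a β α n t f z) ^ 2) ∂(densityField β n η) := by
  filter_upwards [ae_nonExplosive ν d a] with α hα η Ω mΩ P _ ξ h t n hn f hf hf0
  obtain ⟨S, hfS⟩ := exists_finset_scaledSite hn hf
  have hf2S : ∀ x ∉ S, f (scaledSite n x) ^ 2 = 0 := fun x hx => by
    rw [hfS x hx, zero_pow two_ne_zero]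
  have hsemigroup := semigroup_scaledSite (a := a) (β := β) (α := α) hn t hfS
  have hsemigroup_sq := semigroup_scaledSite (a := a) (β := β) (α := α)
    (f := fun w => f w ^ 2) hn t hf2S
  have hs : 0 ≤ ((t * timeScale d β n : ℝ≥0) : ℝ) := NNReal.coe_nonneg _
  have hF0 : ∀ x, 0 ≤ f (scaledSite n x) := fun x => hf0 _
  have hmean := summable_btmSemigroup_mul (a := a) (S := S) η hF0 hs
  have hvariance := (summable_btmSemigroup_mul (a := a) (S := S) η
    (fun x => sq_nonneg (f (scaledSite n x))) hs).sub
    (summable_btmSemigroup_sq_mul (a := a) (S := S) η hF0 hs)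
  refine ⟨fun ω => integrable_densityField (hasSum_pairing hfS _).summable,
    integrable_densityField (by simpa only [hsemigroup] using hmean),
    integrable_densityField
      (by simpa only [hsemigroup, hsemigroup_sq, sub_mul] using hvariance), ?_⟩
  simp only [integral_densityField, (hasSum_pairing hfS _).tsum_eq, hsemigroup, hsemigroup_sq,
    ← mul_sub, mul_pow, integral_const_mul]
  refine ⟨(h.integrable_pairing_sub_sq S _ _ _).const_mul _, ?_⟩
  rw [pow_two, mul_assoc]
  gcongr
  exact h.integral_pairing_sub_sq_le hα hF0 hfS _

open BouchaudExclusion in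
theorem proposition3p1 (d : ℕ) (hd : 1 ≤ d) (β : ℝ) (hβ : β ∈ Set.Ioo (0 : ℝ) 1)
    (a : ℝ) (ha : a ∈ Set.Icc (0 : ℝ) 1)
    (ν : Measure ℕ+) [IsProbabilityMeasure ν] (hν : HeavyTailed ν β) :
    ∀ᵐ α ∂(envLaw d ν),
      ∀ (η : Config α) (Ω : Type*) (mΩ : MeasurableSpace Ω) (P : Measure Ω)
        (_ : IsProbabilityMeasure P) (ξ : ℝ≥0 → Ω → Config α),
        IsExclusionProcess a α η P ξ →
      ∀ (t : ℝ≥0) (n : ℕ), 1 ≤ n →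
      ∀ f : EuclideanSpace ℝ (Fin d) → ℝ, Continuous f → HasCompactSupport f → (∀ z, 0 ≤ f z) →
        -- all the pairings and the expectation are finite
        (∀ ω, Integrable f (densityField β n (ξ (t * timeScale d β n) ω))) ∧
        Integrable (semigroup a β α n t f) (densityField β n η) ∧
        Integrable (fun z => semigroup a β α n t (fun w => f w ^ 2) z
          - (semigroup a β α n t f z) ^ 2) (densityField β n η) ∧
        Integrable (fun ω => (∫ z, f z ∂(densityField β n (ξ (t * timeScale d β n) ω))
          - ∫ z, semigroup a β α n t f z ∂(densityField β n η)) ^ 2) P ∧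
        -- the variance estimate
        ∫ ω, (∫ z, f z ∂(densityField β n (ξ (t * timeScale d β n) ω))
          - ∫ z, semigroup a β α n t f z ∂(densityField β n η)) ^ 2 ∂P
        ≤ 1 / (n : ℝ) ^ ((d : ℝ) / β) *
          ∫ z, (semigroup a β α n t (fun w => f w ^ 2) z
            - (semigroup a β α n t f z) ^ 2) ∂(densityField β n η) := by
  filter_upwards [proposition3p1_general d β a ν] with α hα η Ω mΩ P hP ξ h t n hn f _
  exact hα η Ω mΩ P hP ξ h t n hn f
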